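/- Let $T,\epsilon_1,\epsilon_2,R>0$, $q\in\mathbb R\setminus\{0\}$, $c_1,c_2\in C([0,1])$ real-valued, and $u_0,v_0\in L^2([0,1])$. Let $Q_1,Q_2,P_{f1},P_{f2}\in L^2([0,1]^2)$ be symmetric nonnegative kernels: each such kernel $A$ satisfies $A(x,y)=A(y,x)$ for almost every $(x,y)$, and $\langle f,Af\rangle\ge 0$ for all $f\in L^2([0,1])$, where $(Af)(x)=\int_0^1A(x,y)f(y)\,dy$ and $\langle f,g\rangle=\int_0^1f(x)g(x)\,dx$. For $U\in L^2(0,T)$ consider the boundary controlled system on $[0,1]\times[0,T]$ $$u_t=-\epsilon_1u_x+c_1(x)v,\qquad v_t=\epsilon_2v_x+c_2(x)u,$$ $$u(0,t)=q\,v(0,t),\quad v(1,t)=U(t),\quad u(x,0)=u_0(x),\quad v(x,0)=v_0(x),$$ and the cost $$J(u,v,U)=\tfrac12\int_0^T\big[\langle u(\cdot,t),Q_1u(\cdot,t)\rangle+\langle v(\cdot,t),Q_2v(\cdot,t)\rangle+R\,U(t)^2\big]dt+\tfrac12\langle u(\cdot,T),P_{f1}u(\cdot,T)\rangle+\tfrac12\langle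 v(\cdot,T),P_{f2}v(\cdot,T)\rangle .$$ Solutions of hyperbolic equations are understood in the weak sense: $w\in C([0,T];L^2([0,1]))$ solves $w_t+a\,w_x=f$ with traces $w(0,\cdot),w(1,\cdot)\in L^2(0,T)$ if, for every $\varphi\in C^1([0,1]\times[0,T])$, $$\int_0^T\!\!\int_0^1\big[w(\varphi_t+a\varphi_x)+f\varphi\big]dx\,dt=\int_0^1\big[w(x,T)\varphi(x,T)-w(x,0)\varphi(x,0)\big]dx+a\int_0^T\big[w(1,t)\varphi(1,t)-w(0,t)\varphi(0,t)\big]dt .$$ **Theorem.** Let $(u^*,v^*,U^*)$ minimize $J$ among all triples $(u,v,U)$ with $U\in L^2(0,T)$ and $(u,v)$ a weak solution of the system with control $U$. Then $(u^*,v^*)$ solves the system with control $U^*$, and there are co-states $\lambda_1,\lambda_2\in C([0,T];L^2([0,1]))$, with boundary traces in $L^2(0,T)$, that solve in the weak sense $$-\lambda_{1t}=\epsilon_1\lambda_{1x}+c_2(x)\lambda_2+Q_1u^*,\qquad -\lambda_{2t}=-\epsilon_2\lambda_{2x}+c_1(x)\lambda_1+Q_2v^*,$$ with boundary conditions $\lambda_1(1,t)=0$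 and $\lambda_2(0,t)=q\frac{\epsilon_1}{\epsilon_2}\lambda_1(0,t)$ for almost every $t\in(0,T)$ and terminal conditions $\lambda_1(\cdot,T)=P_{f1}u^*(\cdot,T)$ and $\lambda_2(\cdot,T)=P_{f2}v^*(\cdot,T)$ in $L^2([0,1])$, and the optimal control is $$U^*(t)=-\frac{\epsilon_2}{R}\lambda_2(1,t)\qquad\text{for almost every }t\in(0,T).$$ -/

import Mathlib

open MeasureTheory Set

/-- The Hilbert space `L²([0,1])` of (classes of) real square-integrable functions. -/
abbrev L2I : Type := Lp ℝ 2 (volume.restrict (Icc (0 : ℝ) 1))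

/-- The integral operator `(A f)(x) = ∫₀¹ A(x,y) f(y) dy` with kernel `A`. -/
noncomputable def kernelOp (A : ℝ → ℝ → ℝ) (f : ℝ → ℝ) (x : ℝ) : ℝ :=
  ∫ y in (0 : ℝ)..1, A x y * f y

/-- The inner product `⟨f, g⟩ = ∫₀¹ f(x) g(x) dx`. -/
noncomputable def innerI (f g : ℝ → ℝ) : ℝ :=
  ∫ x in (0 : ℝ)..1, f x * g x

/-- `A ≥ 0` for a weighting kernel: a square-integrable symmetric kernel on `[0,1]²` whose
integral operator on `L²([0,1])` is nonnegative. -/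
structure IsWeightKernel (A : ℝ → ℝ → ℝ) : Prop where
  memLp : MemLp (fun p : ℝ × ℝ => A p.1 p.2) 2
    ((volume.restrict (Icc (0 : ℝ) 1)).prod (volume.restrict (Icc (0 : ℝ) 1)))
  symm : ∀ᵐ p : ℝ × ℝ ∂((volume.restrict (Icc (0 : ℝ) 1)).prod
    (volume.restrict (Icc (0 : ℝ) 1))), A p.1 p.2 = A p.2 p.1
  nonneg : ∀ f : L2I, 0 ≤ innerI f (kernelOp A f)

/-- `φ` (written `φ t x`) is continuously differentiable on the closed rectangle
`0 ≤ t ≤ T`, `0 ≤ x ≤ 1`, with partial derivatives `φt` and `φx` (one-sided on the boundary). -/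
structure IsTestFunction (T : ℝ) (φ φt φx : ℝ → ℝ → ℝ) : Prop where
  cont : ContinuousOn (fun p : ℝ × ℝ => φ p.1 p.2) (Icc 0 T ×ˢ Icc 0 1)
  cont_t : ContinuousOn (fun p : ℝ × ℝ => φt p.1 p.2) (Icc 0 T ×ˢ Icc 0 1)
  cont_x : ContinuousOn (fun p : ℝ × ℝ => φx p.1 p.2) (Icc 0 T ×ˢ Icc 0 1)
  deriv_t : ∀ t ∈ Icc 0 T, ∀ x ∈ Icc (0 : ℝ) 1,
    HasDerivWithinAt (fun s => φ s x) (φt t x) (Icc 0 T) t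
  deriv_x : ∀ t ∈ Icc 0 T, ∀ x ∈ Icc (0 : ℝ) 1,
    HasDerivWithinAt (fun y => φ t y) (φx t x) (Icc 0 1) x

/-- `w ∈ C([0,T]; L²([0,1]))` is a weak solution of the transport equation
`w_t + a w_x = f` on `(0,1) × (0,T)`, with boundary traces
`w(0,·) = wl` and `w(1,·) = wr` in `L²(0,T)`. The integral identity is what multiplication of the
equation by a test function and integration by parts give; since the test functions are not
restricted at the boundary, it determines both traces almost everywhere. -/
structure IsWeakTransport (T a : ℝ) (f : ℝ → ℝ → ℝ) (w : ℝ → L2I) (wl wr : ℝ → ℝ) : Prop where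
  cont : ContinuousOn w (Icc 0 T)
  memLp_left : MemLp wl 2 (volume.restrict (Icc 0 T))
  memLp_right : MemLp wr 2 (volume.restrict (Icc 0 T))
  weak : ∀ φ φt φx : ℝ → ℝ → ℝ, IsTestFunction T φ φt φx →
    (∫ t in (0 : ℝ)..T, (innerI (w t) (fun x => φt t x + a * φx t x) + innerI (f t) (φ t)))
      = innerI (w T) (φ T) - innerI (w 0) (φ 0)
        + a * ∫ t in (0 : ℝ)..T, (wr t * φ t 1 - wl t * φ t 0)

/-- The data of the linear quadratic problem. -/
structure LQData where
  ε₁ : ℝ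
  ε₂ : ℝ
  q : ℝ
  T : ℝ
  R : ℝ
  c₁ : ℝ → ℝ
  c₂ : ℝ → ℝ
  Q₁ : ℝ → ℝ → ℝ
  Q₂ : ℝ → ℝ → ℝ
  Pf₁ : ℝ → ℝ → ℝ
  Pf₂ : ℝ → ℝ → ℝ
  u₀ : L2I
  v₀ : L2I

/-- The standing assumptions on the data. -/
structure LQData.Standing (D : LQData) : Prop where
  ε₁_pos : 0 < D.ε₁
  ε₂_pos : 0 < D.ε₂
  q_ne : D.q ≠ 0
  T_pos : 0 < D.T
  R_pos : 0 < D.R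
  c₁_cont : ContinuousOn D.c₁ (Icc 0 1)
  c₂_cont : ContinuousOn D.c₂ (Icc 0 1)
  Q₁_nonneg : IsWeightKernel D.Q₁
  Q₂_nonneg : IsWeightKernel D.Q₂
  Pf₁_nonneg : IsWeightKernel D.Pf₁
  Pf₂_nonneg : IsWeightKernel D.Pf₂

/-- `(u, v)` is the state of the boundary controlled system with control `U ∈ L²(0,T)`:
`u_t = -ε₁ u_x + c₁ v`, `v_t = ε₂ v_x + c₂ u`, `u(0,t) = q v(0,t)`, `v(1,t) = U(t)`,
`u(·,0) = u₀`, `v(·,0) = v₀`. -/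
def LQData.IsState (D : LQData) (u v : ℝ → L2I) (U : ℝ → ℝ) : Prop :=
  MemLp U 2 (volume.restrict (Icc 0 D.T)) ∧
  ∃ ul ur vl vr : ℝ → ℝ,
    IsWeakTransport D.T D.ε₁ (fun t x => D.c₁ x * v t x) u ul ur ∧
    IsWeakTransport D.T (-D.ε₂) (fun t x => D.c₂ x * u t x) v vl vr ∧
    (∀ᵐ t ∂(volume.restrict (Icc 0 D.T)), ul t = D.q * vl t) ∧
    (∀ᵐ t ∂(volume.restrict (Icc 0 D.T)), vr t = U t) ∧
    u 0 = D.u₀ ∧ v 0 = D.v₀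

/-- The quadratic cost. -/
noncomputable def LQData.cost (D : LQData) (u v : ℝ → L2I) (U : ℝ → ℝ) : ℝ :=
  1 / 2 * (∫ t in (0 : ℝ)..D.T,
      (innerI (u t) (kernelOp D.Q₁ (u t)) + innerI (v t) (kernelOp D.Q₂ (v t)) + D.R * U t ^ 2))
    + 1 / 2 * innerI (u D.T) (kernelOp D.Pf₁ (u D.T))
    + 1 / 2 * innerI (v D.T) (kernelOp D.Pf₂ (v D.T))

/-- `(u, v, U)` minimizes the cost among all controls in `L²(0,T)` and their states. -/
def LQData.IsOptimal (D : LQData) (u v : ℝ → L2I) (U : ℝ → ℝ) : Prop :=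
  D.IsState u v U ∧
  ∀ (u' v' : ℝ → L2I) (U' : ℝ → ℝ), D.IsState u' v' U' → D.cost u v U ≤ D.cost u' v' U'

/-!
The theorem is the first-order optimality condition of a linear quadratic problem, and rests on
Green's formula between the state system and its adjoint. Everything is arranged so that this
formula never has to be applied to two merely weak solutions.

A solution of `w_t + a w_x = f` is kept together with its source and its two traces, as a quadruple
in the Banach space `C([0,T]; L²)² × L²(0,T)²`. The *strong solutions* are the closure of the
quadruples of continuously differentiable functions. Green's formula extends to pairs of strong
solutions by continuity (`greenForm_eq_zero`); weak solutions are exactly the quadruples that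
satisfy it against continuously differentiable functions (`isWeakTransport_iff`), so strong
solutions are weak.

Strong solutions exist for all data. By the energy identity they are bounded by their initial value,
inflow trace and source, so the data that admit a strong solution form a closed subspace, and data
with a dense span suffice: those of smooth profiles carried along the characteristics
(`solvable_homogeneous`) and sources `tⁿ ψ(x)` (`solvable_source`). The coupled system is then
solved by a fixed point argument in an exponentially weighted energy norm
(`exists_coupled_solution`), and the adjoint system becomes one of the same form after time reversal
(`exists_adjoint_solution`).

Given a direction `h` in `L²(0,T)`, let `(d, e)` be the strong solution of the system with zero
initial values and control `h`. Adding `s (d, e, h)` to the optimal triple gives another state, so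
the cost is a quadratic polynomial in `s` that is smallest at `s = 0`, and its linear coefficient
vanishes. Green's formula identifies this coefficient with `⟨h, R U + ε₂ λ₂(1,·)⟩`
(`costVariation_eq`). As `h` is arbitrary, `R U + ε₂ λ₂(1,·) = 0`.
-/

/-! ### Curves in `L²` and the data of a transport problem -/

/-- The space `L²(0,T)` of boundary traces and controls. -/
abbrev L2T (T : ℝ) : Type := Lp ℝ 2 (volume.restrict (Icc (0 : ℝ) T))

/-- The Banach space `C([0,T]; L²([0,1]))`. -/
abbrev Curve (T : ℝ) : Type := C(Icc (0 : ℝ) T, L2I)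

/-- Quadruples `((w, f), (wl, wr))`: state and source in `C([0,T]; L²)`, left and right trace in
`L²(0,T)`. -/
abbrev Quad (T : ℝ) : Type := (Curve T × Curve T) × (L2T T × L2T T)

/-- The value at time `t` of a curve, extended to all of `ℝ` by its values at `0` and `T`. -/
noncomputable def Curve.ev {T : ℝ} [hT : Fact (0 < T)] (w : Curve T) (t : ℝ) : L2I :=
  w (projIcc 0 T hT.out.le t)

section
variable {T : ℝ} [hT : Fact (0 < T)]

namespace Curve

lemma ev_of_mem (w : Curve T) {t : ℝ} (ht : t ∈ Icc 0 T) : w.ev t = w ⟨t, ht⟩ := by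
  simp [ev, projIcc_of_mem _ ht]

lemma ev_coe (w : Curve T) (t : Icc (0 : ℝ) T) : w.ev t = w t := by
  simp [ev]

@[simp] lemma ev_add (w w' : Curve T) (t : ℝ) : (w + w').ev t = w.ev t + w'.ev t := rfl
@[simp] lemma ev_sub (w w' : Curve T) (t : ℝ) : (w - w').ev t = w.ev t - w'.ev t := rfl
@[simp] lemma ev_smul (c : ℝ) (w : Curve T) (t : ℝ) : (c • w).ev t = c • w.ev t := rfl
@[simp] lemma ev_neg (w : Curve T) (t : ℝ) : (-w).ev t = -w.ev t := rfl
@[simp] lemma ev_zero (t : ℝ) : (0 : Curve T).ev t = 0 := rfl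

lemma continuous_ev_prod : Continuous fun z : Curve T × ℝ => z.1.ev z.2 := by
  unfold ev
  exact continuous_eval.comp
    (continuous_fst.prodMk ((continuous_projIcc (h := hT.out.le)).comp continuous_snd))

@[fun_prop] lemma continuous_ev (w : Curve T) : Continuous w.ev :=
  w.continuous.comp continuous_projIcc

lemma norm_ev_le (w : Curve T) (t : ℝ) : ‖w.ev t‖ ≤ ‖w‖ := w.norm_coe_le_norm _

lemma ext_ev {w w' : Curve T} (h : ∀ t ∈ Icc 0 T, w.ev t = w'.ev t) : w = w' := by
  ext1 t
  rw [← ev_coe, ← ev_coe, h t t.2]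

/-- A curve continuous on `[0,T]` as an element of `C([0,T]; L²)`. -/
noncomputable def ofContinuousOn (w : ℝ → L2I) (hw : ContinuousOn w (Icc 0 T)) : Curve T :=
  ⟨(Icc 0 T).domRestrict w, hw.domRestrict⟩

lemma ev_ofContinuousOn (w : ℝ → L2I) (hw : ContinuousOn w (Icc 0 T)) {t : ℝ}
    (ht : t ∈ Icc 0 T) : (ofContinuousOn w hw).ev t = w t := by
  rw [ev_of_mem _ ht]; rfl

end Curve

lemma zero_mem_Icc_time : (0 : ℝ) ∈ Icc 0 T := ⟨le_rfl, hT.out.le⟩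
lemma end_mem_Icc_time : T ∈ Icc 0 T := ⟨hT.out.le, le_rfl⟩

end

lemma innerI_eq_setIntegral (f g : ℝ → ℝ) : innerI f g = ∫ x in Icc (0 : ℝ) 1, f x * g x := by
  rw [innerI, intervalIntegral.integral_of_le zero_le_one, integral_Icc_eq_integral_Ioc]

lemma innerI_congr {f f' g g' : ℝ → ℝ} (hf : f =ᵐ[volume.restrict (Icc (0 : ℝ) 1)] f')
    (hg : g =ᵐ[volume.restrict (Icc (0 : ℝ) 1)] g') : innerI f g = innerI f' g' := by
  simp only [innerI_eq_setIntegral]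
  refine integral_congr_ae ?_
  filter_upwards [hf, hg] with x h1 h2
  rw [h1, h2]

lemma inner_L2I_eq (f g : L2I) : inner ℝ f g = innerI f g := by
  rw [L2.inner_def, innerI_eq_setIntegral]
  simp [mul_comm]

lemma inner_L2I_eq_of_ae {f g : L2I} {f' g' : ℝ → ℝ}
    (hf : f =ᵐ[volume.restrict (Icc (0 : ℝ) 1)] f')
    (hg : g =ᵐ[volume.restrict (Icc (0 : ℝ) 1)] g') : inner ℝ f g = innerI f' g' := by
  rw [inner_L2I_eq, innerI_congr hf hg]

/-- The pairing `∫₀^τ g h dt` of two elements of `L²(0,T)`. -/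
noncomputable def pairTo {T : ℝ} (τ : ℝ) (g h : L2T T) : ℝ :=
  inner ℝ (LpToLpRestrictCLM ℝ ℝ ℝ (volume.restrict (Icc 0 T)) 2 (Icc 0 τ) g)
    (LpToLpRestrictCLM ℝ ℝ ℝ (volume.restrict (Icc 0 T)) 2 (Icc 0 τ) h)

lemma pairTo_eq {T τ : ℝ} (hτ : τ ≤ T) (g h : L2T T) :
    pairTo τ g h = ∫ t in Icc 0 τ, g t * h t := by
  have hm : (volume.restrict (Icc 0 T)).restrict (Icc 0 τ) = volume.restrict (Icc 0 τ) := by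
    rw [Measure.restrict_restrict measurableSet_Icc, inter_eq_left.2 (Icc_subset_Icc_right hτ)]
  rw [pairTo, L2.inner_def, ← hm]
  refine integral_congr_ae ?_
  filter_upwards [LpToLpRestrictCLM_coeFn ℝ (Icc 0 τ) g,
    LpToLpRestrictCLM_coeFn ℝ (Icc 0 τ) h] with t h1 h2
  rw [h1, h2]; simp [mul_comm]

lemma pairTo_self_eq_inner {T : ℝ} (g h : L2T T) : pairTo T g h = inner ℝ g h := by
  rw [pairTo_eq le_rfl, L2.inner_def]
  simp [mul_comm]

lemma pairTo_nonneg {T τ : ℝ} (g : L2T T) : 0 ≤ pairTo τ g g := real_inner_self_nonneg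

lemma pairTo_le {T τ : ℝ} (g : L2T T) : pairTo τ g g ≤ ‖g‖ ^ 2 := by
  rw [pairTo, real_inner_self_eq_norm_sq]
  gcongr
  exact norm_Lp_toLp_restrict_le _ g

lemma continuous_pairTo {T : ℝ} (τ : ℝ) :
    Continuous fun z : L2T T × L2T T => pairTo τ z.1 z.2 := by
  unfold pairTo
  fun_prop

lemma pairTo_add_smul {T : ℝ} (τ s : ℝ) (g g' h : L2T T) :
    pairTo τ (g + s • g') h = pairTo τ g h + s * pairTo τ g' h := by
  simp only [pairTo, map_add, map_smul, inner_add_left, real_inner_smul_left]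

lemma pairTo_smul_smul {T : ℝ} (τ s : ℝ) (g : L2T T) :
    pairTo τ (s • g) (s • g) = s ^ 2 * pairTo τ g g := by
  simp only [pairTo, map_smul, real_inner_smul_left, real_inner_smul_right]; ring

/-! ### Green's formula for continuously differentiable functions -/

namespace IsTestFunction

variable {T : ℝ} {φ φt φx ψ ψt ψx : ℝ → ℝ → ℝ}

lemma mul (hφ : IsTestFunction T φ φt φx) (hψ : IsTestFunction T ψ ψt ψx) :
    IsTestFunction T (fun t x => φ t x * ψ t x) (fun t x => φt t x * ψ t x + φ t x * ψt t x)
      (fun t x => φx t x * ψ t x + φ t x * ψx t x) where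
  cont := hφ.cont.mul hψ.cont
  cont_t := (hφ.cont_t.mul hψ.cont).add (hφ.cont.mul hψ.cont_t)
  cont_x := (hφ.cont_x.mul hψ.cont).add (hφ.cont.mul hψ.cont_x)
  deriv_t t ht x hx := (hφ.deriv_t t ht x hx).mul (hψ.deriv_t t ht x hx)
  deriv_x t ht x hx := (hφ.deriv_x t ht x hx).mul (hψ.deriv_x t ht x hx)

lemma add_smul (hφ : IsTestFunction T φ φt φx) (hψ : IsTestFunction T ψ ψt ψx) (c : ℝ) :
    IsTestFunction T (fun t x => φ t x + c * ψ t x) (fun t x => φt t x + c * ψt t x)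
      (fun t x => φx t x + c * ψx t x) where
  cont := hφ.cont.add (hψ.cont.const_mul c)
  cont_t := hφ.cont_t.add (hψ.cont_t.const_mul c)
  cont_x := hφ.cont_x.add (hψ.cont_x.const_mul c)
  deriv_t t ht x hx := (hφ.deriv_t t ht x hx).add ((hψ.deriv_t t ht x hx).const_mul c)
  deriv_x t ht x hx := (hφ.deriv_x t ht x hx).add ((hψ.deriv_x t ht x hx).const_mul c)

lemma zero : IsTestFunction T (fun _ _ => 0) (fun _ _ => 0) (fun _ _ => 0) where
  cont := continuousOn_const
  cont_t := continuousOn_const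
  cont_x := continuousOn_const
  deriv_t _ _ _ _ := hasDerivWithinAt_const ..
  deriv_x _ _ _ _ := hasDerivWithinAt_const ..

/-- Integration of the transport operator over `[0,τ] × [0,1]`. -/
lemma integral_transport (hψ : IsTestFunction T ψ ψt ψx) (a : ℝ) {τ : ℝ} (hτ : τ ∈ Icc 0 T) :
    ∫ t in (0 : ℝ)..τ, ∫ x in (0 : ℝ)..1, (ψt t x + a * ψx t x) =
      (∫ x in (0 : ℝ)..1, ψ τ x) - (∫ x in (0 : ℝ)..1, ψ 0 x)
        + a * ∫ t in (0 : ℝ)..τ, (ψ t 1 - ψ t 0) := by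
  have hsub : Icc 0 τ ⊆ Icc 0 T := Icc_subset_Icc_right hτ.2
  have h0 : (0 : ℝ) ∈ Icc 0 T := ⟨le_rfl, hτ.1.trans hτ.2⟩
  have cx : ∀ {θ : ℝ → ℝ → ℝ}, ContinuousOn (fun p : ℝ × ℝ => θ p.1 p.2) (Icc 0 T ×ˢ Icc 0 1) →
      ∀ t ∈ Icc 0 T, ContinuousOn (fun x => θ t x) (Icc 0 1) := fun h t ht =>
    h.comp (by fun_prop : ContinuousOn (fun x : ℝ => (t, x)) _) fun x hx => ⟨ht, hx⟩
  have ct : ∀ {θ : ℝ → ℝ → ℝ}, ContinuousOn (fun p : ℝ × ℝ => θ p.1 p.2) (Icc 0 T ×ˢ Icc 0 1) →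
      ∀ x ∈ Icc (0 : ℝ) 1, ContinuousOn (fun t => θ t x) (Icc 0 τ) := fun h x hx =>
    h.comp (by fun_prop : ContinuousOn (fun t : ℝ => (t, x)) _) fun t ht => ⟨hsub ht, hx⟩
  have ix : ∀ {θ : ℝ → ℝ → ℝ}, ContinuousOn (fun p : ℝ × ℝ => θ p.1 p.2) (Icc 0 T ×ˢ Icc 0 1) →
      ∀ t ∈ Icc 0 T, IntervalIntegrable (fun x => θ t x) volume 0 1 := fun h t ht =>
    (cx h t ht).intervalIntegrable_of_Icc zero_le_one
  have it : ∀ {θ : ℝ → ℝ → ℝ}, ContinuousOn (fun p : ℝ × ℝ => θ p.1 p.2) (Icc 0 T ×ˢ Icc 0 1) →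
      ∀ x ∈ Icc (0 : ℝ) 1, IntervalIntegrable (fun t => θ t x) volume 0 τ := fun h x hx =>
    (ct h x hx).intervalIntegrable_of_Icc hτ.1
  have hint : ∀ {θ : ℝ → ℝ → ℝ},
      ContinuousOn (fun p : ℝ × ℝ => θ p.1 p.2) (Icc 0 T ×ˢ Icc 0 1) →
      IntegrableOn (Function.uncurry θ) (uIoc 0 τ ×ˢ uIoc 0 1) := by
    intro θ h
    rw [uIoc_of_le hτ.1, uIoc_of_le zero_le_one]
    exact ((h.mono (prod_mono hsub subset_rfl)).integrableOn_compact
      (isCompact_Icc.prod isCompact_Icc)).mono_set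
        (prod_mono Ioc_subset_Icc_self Ioc_subset_Icc_self)
  have iit : ∀ {θ : ℝ → ℝ → ℝ},
      ContinuousOn (fun p : ℝ × ℝ => θ p.1 p.2) (Icc 0 T ×ˢ Icc 0 1) →
      IntervalIntegrable (fun t => ∫ x in (0 : ℝ)..1, θ t x) volume 0 τ := by
    intro θ h
    have := hint h
    rw [uIoc_of_le hτ.1, uIoc_of_le zero_le_one, IntegrableOn, Measure.volume_eq_prod,
      ← Measure.prod_restrict] at this
    rw [intervalIntegrable_iff_integrableOn_Ioc_of_le hτ.1]
    simp only [intervalIntegral.integral_of_le zero_le_one]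
    exact this.integral_prod_left
  have e1 : ∫ t in (0 : ℝ)..τ, ∫ x in (0 : ℝ)..1, (ψt t x + a * ψx t x) =
      (∫ t in (0 : ℝ)..τ, ∫ x in (0 : ℝ)..1, ψt t x)
        + a * ∫ t in (0 : ℝ)..τ, ∫ x in (0 : ℝ)..1, ψx t x := by
    rw [← intervalIntegral.integral_const_mul,
      ← intervalIntegral.integral_add (iit hψ.cont_t) ((iit hψ.cont_x).const_mul a)]
    refine intervalIntegral.integral_congr fun t ht => ?_
    rw [uIcc_of_le hτ.1] at ht
    rw [intervalIntegral.integral_add (ix hψ.cont_t t (hsub ht))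
      ((ix hψ.cont_x t (hsub ht)).const_mul a), intervalIntegral.integral_const_mul]
  rw [e1, intervalIntegral_intervalIntegral_swap (hint hψ.cont_t),
    ← intervalIntegral.integral_sub (ix hψ.cont τ hτ) (ix hψ.cont 0 h0)]
  congr 1
  · refine intervalIntegral.integral_congr fun x hx => ?_
    rw [uIcc_of_le zero_le_one] at hx
    refine intervalIntegral.integral_eq_sub_of_hasDerivAt_of_le hτ.1 (ct hψ.cont x hx)
      (fun t ht => ?_) (it hψ.cont_t x hx)
    exact (hψ.deriv_t t (hsub (Ioo_subset_Icc_self ht)) x hx).hasDerivAt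
      (Icc_mem_nhds ht.1 (ht.2.trans_le hτ.2))
  · congr 1
    refine intervalIntegral.integral_congr fun t ht => ?_
    rw [uIcc_of_le hτ.1] at ht
    refine intervalIntegral.integral_eq_sub_of_hasDerivAt_of_le zero_le_one
      (cx hψ.cont t (hsub ht)) (fun x hx => ?_) (ix hψ.cont_x t (hsub ht))
    exact (hψ.deriv_x t (hsub ht) x (Ioo_subset_Icc_self hx)).hasDerivAt (Icc_mem_nhds hx.1 hx.2)

end IsTestFunction

/-! ### Classical solutions and Green's form -/

/-- A continuous function on `[0,1]` as an element of `L²([0,1])`. -/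
noncomputable def contToL2 (g : C(Icc (0 : ℝ) 1, ℝ)) : L2I :=
  BoundedContinuousFunction.toLp 2 _ ℝ
    ((BoundedContinuousFunction.mkOfCompact g).compContinuous
      ⟨projIcc 0 1 zero_le_one, continuous_projIcc⟩)

lemma contToL2_ae (g : C(Icc (0 : ℝ) 1, ℝ)) {θ : ℝ → ℝ}
    (h : ∀ x (hx : x ∈ Icc (0 : ℝ) 1), g ⟨x, hx⟩ = θ x) :
    contToL2 g =ᵐ[volume.restrict (Icc (0 : ℝ) 1)] θ := by
  filter_upwards [BoundedContinuousFunction.coeFn_toLp (p := 2)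
    (μ := volume.restrict (Icc (0 : ℝ) 1)) (𝕜 := ℝ)
    ((BoundedContinuousFunction.mkOfCompact g).compContinuous
      ⟨projIcc 0 1 zero_le_one, continuous_projIcc⟩),
    ae_restrict_mem measurableSet_Icc] with x h1 hx
  rw [contToL2, h1, ← h x hx]
  simp [projIcc_of_mem _ hx]

lemma continuous_contToL2 : Continuous contToL2 := by
  refine (BoundedContinuousFunction.toLp 2 _ ℝ).continuous.comp ?_
  refine (BoundedContinuousFunction.continuous_compContinuous _).comp ?_
  exact (ContinuousMap.isometryEquivBoundedOfCompact (Icc (0 : ℝ) 1) ℝ).continuous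

lemma exists_curve {T : ℝ} [hT : Fact (0 < T)] {θ : ℝ → ℝ → ℝ}
    (hθ : ContinuousOn (fun p : ℝ × ℝ => θ p.1 p.2) (Icc 0 T ×ˢ Icc 0 1)) :
    ∃ w : Curve T, ∀ t ∈ Icc 0 T, w.ev t =ᵐ[volume.restrict (Icc (0 : ℝ) 1)] θ t := by
  let Θ : C(Icc (0 : ℝ) T × Icc (0 : ℝ) 1, ℝ) :=
    ⟨fun z => θ z.1 z.2, hθ.comp_continuous (f := fun z : Icc (0 : ℝ) T × Icc (0 : ℝ) 1 =>
      ((z.1 : ℝ), (z.2 : ℝ))) (by fun_prop) fun z => ⟨z.1.2, z.2.2⟩⟩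
  refine ⟨⟨fun t => contToL2 (Θ.curry t), continuous_contToL2.comp Θ.curry.continuous⟩,
    fun t ht => ?_⟩
  rw [Curve.ev_of_mem _ ht]
  exact contToL2_ae _ fun x hx => rfl

lemma memLp_of_continuousOn {a b : ℝ} {g : ℝ → ℝ} (hg : ContinuousOn g (Icc a b)) :
    MemLp g 2 (volume.restrict (Icc a b)) := by
  obtain ⟨C, hC⟩ := isCompact_Icc.exists_bound_of_continuousOn hg
  refine MemLp.of_bound (hg.aestronglyMeasurable measurableSet_Icc) C ?_
  filter_upwards [ae_restrict_mem measurableSet_Icc] with x hx using hC x hx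

section
variable {T : ℝ} [hT : Fact (0 < T)]

/-- The quadruple `p` consists of a function `φ`, its image `φt + a φx` under the transport
operator, and its boundary values. -/
structure Represents (a : ℝ) (φ φt φx : ℝ → ℝ → ℝ) (p : Quad T) : Prop where
  test : IsTestFunction T φ φt φx
  state : ∀ t ∈ Icc 0 T, p.1.1.ev t =ᵐ[volume.restrict (Icc (0 : ℝ) 1)] φ t
  source : ∀ t ∈ Icc 0 T,
    p.1.2.ev t =ᵐ[volume.restrict (Icc (0 : ℝ) 1)] fun x => φt t x + a * φx t x
  left : p.2.1 =ᵐ[volume.restrict (Icc 0 T)] fun t => φ t 0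
  right : p.2.2 =ᵐ[volume.restrict (Icc 0 T)] fun t => φ t 1

lemma IsTestFunction.exists_represents {φ φt φx : ℝ → ℝ → ℝ} (hφ : IsTestFunction T φ φt φx)
    (a : ℝ) : ∃ p : Quad T, Represents a φ φt φx p := by
  obtain ⟨w, hw⟩ := exists_curve hφ.cont
  obtain ⟨f, hf⟩ := exists_curve (θ := fun t x => φt t x + a * φx t x)
    (hφ.cont_t.add (hφ.cont_x.const_mul a))
  have ct : ∀ x ∈ Icc (0 : ℝ) 1, MemLp (fun t => φ t x) 2 (volume.restrict (Icc 0 T)) :=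
    fun x hx => memLp_of_continuousOn <|
      hφ.cont.comp (by fun_prop : ContinuousOn (fun t : ℝ => (t, x)) _) fun t ht => ⟨ht, hx⟩
  have h0 := ct 0 (by simp)
  have h1 := ct 1 (by simp)
  exact ⟨((w, f), (h0.toLp, h1.toLp)), hφ, hw, hf, h0.coeFn_toLp, h1.coeFn_toLp⟩

/-- The defect, up to time `τ`, in the integration by parts formula for the operator
`∂ₜ + a ∂ₓ`. It vanishes when both quadruples come from functions that are regular enough. -/
noncomputable def greenForm (a τ : ℝ) (p p' : Quad T) : ℝ :=
  (∫ t in (0 : ℝ)..τ,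
      (inner ℝ (p.1.1.ev t) (p'.1.2.ev t) + inner ℝ (p.1.2.ev t) (p'.1.1.ev t)))
    - inner ℝ (p.1.1.ev τ) (p'.1.1.ev τ) + inner ℝ (p.1.1.ev 0) (p'.1.1.ev 0)
    - a * (pairTo τ p.2.2 p'.2.2 - pairTo τ p.2.1 p'.2.1)

lemma continuous_greenForm (a τ : ℝ) :
    Continuous fun z : Quad T × Quad T => greenForm a τ z.1 z.2 := by
  have hev : ∀ {X : Type} [TopologicalSpace X] {F : X → Curve T} {s : X → ℝ},
      Continuous F → Continuous s → Continuous fun x => (F x).ev (s x) := fun hF hs =>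
    Curve.continuous_ev_prod.comp (hF.prodMk hs)
  have hpair : ∀ {F G : Quad T × Quad T → L2T T}, Continuous F → Continuous G →
      Continuous fun x => pairTo τ (F x) (G x) := fun hF hG =>
    (continuous_pairTo τ).comp (hF.prodMk hG)
  unfold greenForm
  refine ((Continuous.sub ?_ ?_).add ?_).sub (continuous_const.mul (Continuous.sub ?_ ?_))
  · refine intervalIntegral.continuous_parametric_intervalIntegral_of_continuous' ?_ 0 τ
    exact ((hev (by fun_prop) (by fun_prop)).inner (hev (by fun_prop) (by fun_prop))).add
      ((hev (by fun_prop) (by fun_prop)).inner (hev (by fun_prop) (by fun_prop)))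
  · exact (hev (by fun_prop) (by fun_prop)).inner (hev (by fun_prop) (by fun_prop))
  · exact (hev (by fun_prop) (by fun_prop)).inner (hev (by fun_prop) (by fun_prop))
  · exact hpair (by fun_prop) (by fun_prop)
  · exact hpair (by fun_prop) (by fun_prop)

lemma greenForm_add_smul (a τ s : ℝ) (p p' r : Quad T) :
    greenForm a τ (p + s • p') r = greenForm a τ p r + s * greenForm a τ p' r := by
  simp only [greenForm, Prod.fst_add, Prod.snd_add, Prod.smul_fst, Prod.smul_snd, Curve.ev_add,
    Curve.ev_smul, inner_add_left, real_inner_smul_left, pairTo_add_smul]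
  have hi : ∀ q : Quad T, IntervalIntegrable (fun t => inner ℝ (q.1.1.ev t) (r.1.2.ev t)
      + inner ℝ (q.1.2.ev t) (r.1.1.ev t)) volume 0 τ := fun q =>
    Continuous.intervalIntegrable (by fun_prop) _ _
  have : ∀ t, inner ℝ (p.1.1.ev t) (r.1.2.ev t) + s * inner ℝ (p'.1.1.ev t) (r.1.2.ev t)
      + (inner ℝ (p.1.2.ev t) (r.1.1.ev t) + s * inner ℝ (p'.1.2.ev t) (r.1.1.ev t))
      = (inner ℝ (p.1.1.ev t) (r.1.2.ev t) + inner ℝ (p.1.2.ev t) (r.1.1.ev t))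
        + s * (inner ℝ (p'.1.1.ev t) (r.1.2.ev t) + inner ℝ (p'.1.2.ev t) (r.1.1.ev t)) :=
    fun t => by ring
  simp only [this]
  rw [intervalIntegral.integral_add (hi p) ((hi p').const_mul s),
    intervalIntegral.integral_const_mul]
  ring

/-- Green's formula for continuously differentiable functions. -/
lemma Represents.greenForm_eq_zero {a τ : ℝ} {φ φt φx ψ ψt ψx : ℝ → ℝ → ℝ} {p p' : Quad T}
    (hp : Represents a φ φt φx p) (hp' : Represents a ψ ψt ψx p') (hτ : τ ∈ Icc 0 T) :
    greenForm a τ p p' = 0 := by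
  have hsub : Icc 0 τ ⊆ Icc 0 T := Icc_subset_Icc_right hτ.2
  have cx : ∀ {θ : ℝ → ℝ → ℝ}, ContinuousOn (fun p : ℝ × ℝ => θ p.1 p.2) (Icc 0 T ×ˢ Icc 0 1) →
      ∀ t ∈ Icc 0 T, ContinuousOn (fun x => θ t x) (Icc 0 1) := fun h t ht =>
    h.comp (by fun_prop : ContinuousOn (fun x : ℝ => (t, x)) _) fun x hx => ⟨ht, hx⟩
  have ct : ∀ {θ : ℝ → ℝ → ℝ}, ContinuousOn (fun p : ℝ × ℝ => θ p.1 p.2) (Icc 0 T ×ˢ Icc 0 1) →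
      ∀ x ∈ Icc (0 : ℝ) 1, IntervalIntegrable (fun t => θ t x) volume 0 τ := fun h x hx =>
    ContinuousOn.intervalIntegrable_of_Icc hτ.1 <|
      h.comp (by fun_prop : ContinuousOn (fun t : ℝ => (t, x)) _) fun t ht => ⟨hsub ht, hx⟩
  have h := (hp.test.mul hp'.test).integral_transport a hτ
  have e1 : ∫ t in (0 : ℝ)..τ,
      (inner ℝ (p.1.1.ev t) (p'.1.2.ev t) + inner ℝ (p.1.2.ev t) (p'.1.1.ev t))
      = ∫ t in (0 : ℝ)..τ, ∫ x in (0 : ℝ)..1, ((φt t x * ψ t x + φ t x * ψt t x)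
        + a * (φx t x * ψ t x + φ t x * ψx t x)) := by
    refine intervalIntegral.integral_congr fun t ht => ?_
    rw [uIcc_of_le hτ.1] at ht
    have ht' := hsub ht
    rw [inner_L2I_eq_of_ae (hp.state t ht') (hp'.source t ht'),
      inner_L2I_eq_of_ae (hp.source t ht') (hp'.state t ht'), innerI, innerI,
      ← intervalIntegral.integral_add]
    · refine intervalIntegral.integral_congr fun x _ => ?_
      ring
    · exact ((cx hp.test.cont t ht').mul ((cx hp'.test.cont_t t ht').add
        ((cx hp'.test.cont_x t ht').const_mul a))).intervalIntegrable_of_Icc zero_le_one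
    · exact (((cx hp.test.cont_t t ht').add ((cx hp.test.cont_x t ht').const_mul a)).mul
        (cx hp'.test.cont t ht')).intervalIntegrable_of_Icc zero_le_one
  have pr : ∀ {g h : L2T T} {g' h' : ℝ → ℝ}, g =ᵐ[volume.restrict (Icc 0 T)] g' →
      h =ᵐ[volume.restrict (Icc 0 T)] h' →
      pairTo τ g h = ∫ t in (0 : ℝ)..τ, g' t * h' t := by
    intro g h g' h' hg hh
    rw [pairTo_eq hτ.2, intervalIntegral.integral_of_le hτ.1, ← integral_Icc_eq_integral_Ioc]
    refine integral_congr_ae ?_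
    filter_upwards [ae_restrict_of_ae_restrict_of_subset hsub hg,
      ae_restrict_of_ae_restrict_of_subset hsub hh] with t h1 h2
    rw [h1, h2]
  have h0 := zero_mem_Icc_time (T := T)
  rw [greenForm, e1, h, inner_L2I_eq_of_ae (hp.state τ hτ) (hp'.state τ hτ),
    inner_L2I_eq_of_ae (hp.state 0 h0) (hp'.state 0 h0), pr hp.left hp'.left,
    pr hp.right hp'.right, innerI, innerI, intervalIntegral.integral_sub]
  · ring
  · exact ct (θ := fun t x => φ t x * ψ t x) (hp.test.mul hp'.test).cont 1 (by simp)
  · exact ct (θ := fun t x => φ t x * ψ t x) (hp.test.mul hp'.test).cont 0 (by simp)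

/-! ### Strong solutions -/

variable (T) in
/-- The quadruples of continuously differentiable functions. -/
noncomputable def classicalSolutions (a : ℝ) : Submodule ℝ (Quad T) where
  carrier := {p | ∃ φ φt φx, Represents a φ φt φx p}
  zero_mem' := ⟨_, _, _, IsTestFunction.zero, fun _ _ => Lp.coeFn_zero _ _ _,
    fun _ _ => (Lp.coeFn_zero _ _ _).trans (by simp; rfl), Lp.coeFn_zero _ _ _, Lp.coeFn_zero _ _ _⟩
  add_mem' := by
    rintro p p' ⟨φ, φt, φx, hp⟩ ⟨ψ, ψt, ψx, hp'⟩
    refine ⟨_, _, _, hp.test.add_smul hp'.test 1, fun t ht => ?_, fun t ht => ?_, ?_, ?_⟩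
    · filter_upwards [Lp.coeFn_add (p.1.1.ev t) (p'.1.1.ev t), hp.state t ht, hp'.state t ht]
        with x h1 h2 h3 using h1.trans (by rw [Pi.add_apply, h2, h3]; ring)
    · filter_upwards [Lp.coeFn_add (p.1.2.ev t) (p'.1.2.ev t), hp.source t ht, hp'.source t ht]
        with x h1 h2 h3 using h1.trans (by rw [Pi.add_apply, h2, h3]; ring)
    · filter_upwards [Lp.coeFn_add p.2.1 p'.2.1, hp.left, hp'.left]
        with x h1 h2 h3 using h1.trans (by rw [Pi.add_apply, h2, h3]; ring)
    · filter_upwards [Lp.coeFn_add p.2.2 p'.2.2, hp.right, hp'.right]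
        with x h1 h2 h3 using h1.trans (by rw [Pi.add_apply, h2, h3]; ring)
  smul_mem' := by
    rintro c p ⟨φ, φt, φx, hp⟩
    refine ⟨_, _, _, IsTestFunction.zero.add_smul hp.test c, fun t ht => ?_, fun t ht => ?_, ?_, ?_⟩
    · filter_upwards [Lp.coeFn_smul c (p.1.1.ev t), hp.state t ht] with x h1 h2
        using h1.trans (by rw [Pi.smul_apply, h2, smul_eq_mul]; ring)
    · filter_upwards [Lp.coeFn_smul c (p.1.2.ev t), hp.source t ht] with x h1 h2
        using h1.trans (by rw [Pi.smul_apply, h2, smul_eq_mul]; ring)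
    · filter_upwards [Lp.coeFn_smul c p.2.1, hp.left] with x h1 h2
        using h1.trans (by rw [Pi.smul_apply, h2, smul_eq_mul]; ring)
    · filter_upwards [Lp.coeFn_smul c p.2.2, hp.right] with x h1 h2
        using h1.trans (by rw [Pi.smul_apply, h2, smul_eq_mul]; ring)

variable (T) in
/-- Strong solutions `((w, f), (wl, wr))` of `w_t + a w_x = f`: limits, in the norm of
`C([0,T]; L²)² × L²(0,T)²`, of continuously differentiable functions. -/
noncomputable def strongSolutions (a : ℝ) : Submodule ℝ (Quad T) :=
  (classicalSolutions T a).topologicalClosure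

/-- Green's formula extends to strong solutions by continuity. -/
lemma greenForm_eq_zero {a τ : ℝ} {p p' : Quad T} (hp : p ∈ strongSolutions T a)
    (hp' : p' ∈ strongSolutions T a) (hτ : τ ∈ Icc 0 T) : greenForm a τ p p' = 0 := by
  have h : greenForm a τ p p' ∈ closure {0} :=
    map_mem_closure₂ (continuous_greenForm a τ) hp hp' <| by
      rintro z ⟨_, _, _, hz⟩ z' ⟨_, _, _, hz'⟩
      exact hz.greenForm_eq_zero hz' hτ
  simpa using h

/-- A quadruple satisfies the weak formulation exactly when Green's formula holds against all
continuously differentiable functions. -/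
lemma isWeakTransport_iff {a : ℝ} {f : ℝ → ℝ → ℝ} {w : ℝ → L2I} {wl wr : ℝ → ℝ} {p : Quad T}
    (hw : ∀ t ∈ Icc 0 T, p.1.1.ev t = w t)
    (hf : ∀ t ∈ Icc 0 T, p.1.2.ev t =ᵐ[volume.restrict (Icc (0 : ℝ) 1)] f t)
    (hl : p.2.1 =ᵐ[volume.restrict (Icc 0 T)] wl) (hr : p.2.2 =ᵐ[volume.restrict (Icc 0 T)] wr) :
    IsWeakTransport T a f w wl wr ↔ ∀ p' ∈ classicalSolutions T a, greenForm a T p p' = 0 := by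
  have key : ∀ φ φt φx p', Represents a φ φt φx p' → (greenForm a T p p' = 0 ↔
      (∫ t in (0 : ℝ)..T, (innerI (w t) (fun x => φt t x + a * φx t x) + innerI (f t) (φ t)))
      = innerI (w T) (φ T) - innerI (w 0) (φ 0)
        + a * ∫ t in (0 : ℝ)..T, (wr t * φ t 1 - wl t * φ t 0)) := by
    intro φ φt φx p' hp'
    have e1 : ∫ t in (0 : ℝ)..T,
        (inner ℝ (p.1.1.ev t) (p'.1.2.ev t) + inner ℝ (p.1.2.ev t) (p'.1.1.ev t))
        = ∫ t in (0 : ℝ)..T,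
          (innerI (w t) (fun x => φt t x + a * φx t x) + innerI (f t) (φ t)) := by
      refine intervalIntegral.integral_congr fun t ht => ?_
      rw [uIcc_of_le hT.out.le] at ht
      rw [inner_L2I_eq_of_ae (.of_eq (by rw [hw t ht])) (hp'.source t ht),
        inner_L2I_eq_of_ae (hf t ht) (hp'.state t ht)]
    have e2 : ∀ t ∈ Icc 0 T, inner ℝ (p.1.1.ev t) (p'.1.1.ev t) = innerI (w t) (φ t) :=
      fun t ht => inner_L2I_eq_of_ae (.of_eq (by rw [hw t ht])) (hp'.state t ht)
    have e3 : pairTo T p.2.2 p'.2.2 - pairTo T p.2.1 p'.2.1 =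
        ∫ t in (0 : ℝ)..T, (wr t * φ t 1 - wl t * φ t 0) := by
      rw [pairTo_eq le_rfl, pairTo_eq le_rfl,
        ← integral_sub (f := fun t => p.2.2 t * p'.2.2 t) (g := fun t => p.2.1 t * p'.2.1 t)
          ((Lp.memLp p.2.2).integrable_mul (Lp.memLp p'.2.2))
          ((Lp.memLp p.2.1).integrable_mul (Lp.memLp p'.2.1)),
        intervalIntegral.integral_of_le hT.out.le, ← integral_Icc_eq_integral_Ioc]
      refine integral_congr_ae ?_
      filter_upwards [hl, hr, hp'.left, hp'.right] with t h1 h2 h3 h4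
      simp [h1, h2, h3, h4]
    rw [greenForm, e1, e2 _ end_mem_Icc_time, e2 _ zero_mem_Icc_time, e3]
    constructor <;> intro h <;> linarith
  constructor
  · rintro h p' ⟨φ, φt, φx, hp'⟩
    exact (key _ _ _ _ hp').2 (h.weak _ _ _ hp'.test)
  · refine fun h => ⟨?_, (memLp_congr_ae hl).1 (Lp.memLp _), (memLp_congr_ae hr).1 (Lp.memLp _),
      fun φ φt φx hφ => ?_⟩
    · exact p.1.1.continuous_ev.continuousOn.congr fun t ht => (hw t ht).symm
    · obtain ⟨p', hp'⟩ := hφ.exists_represents a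
      exact (key _ _ _ _ hp').1 (h p' ⟨_, _, _, hp'⟩)

end

/-! ### The energy identity -/

/-- The trace on the side of the interval where characteristics enter. -/
noncomputable def inflow (T a : ℝ) : Quad T →L[ℝ] L2T T :=
  if 0 < a then (ContinuousLinearMap.fst ℝ _ _).comp (ContinuousLinearMap.snd ℝ _ _)
  else (ContinuousLinearMap.snd ℝ _ _).comp (ContinuousLinearMap.snd ℝ _ _)

/-- The trace on the side of the interval where characteristics leave. -/
noncomputable def outflow (T a : ℝ) : Quad T →L[ℝ] L2T T :=
  if 0 < a then (ContinuousLinearMap.snd ℝ _ _).comp (ContinuousLinearMap.snd ℝ _ _)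
  else (ContinuousLinearMap.fst ℝ _ _).comp (ContinuousLinearMap.snd ℝ _ _)

lemma inflow_of_pos {T a : ℝ} (ha : 0 < a) (p : Quad T) : inflow T a p = p.2.1 := by
  simp [inflow, ha]
lemma inflow_of_neg {T a : ℝ} (ha : a < 0) (p : Quad T) : inflow T a p = p.2.2 := by
  simp [inflow, ha.le.not_gt]
lemma outflow_of_pos {T a : ℝ} (ha : 0 < a) (p : Quad T) : outflow T a p = p.2.2 := by
  simp [outflow, ha]
lemma outflow_of_neg {T a : ℝ} (ha : a < 0) (p : Quad T) : outflow T a p = p.2.1 := by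
  simp [outflow, ha.le.not_gt]

section
variable {T : ℝ} [hT : Fact (0 < T)]

lemma energy_identity {a : ℝ} {p : Quad T} (hp : p ∈ strongSolutions T a) {τ : ℝ}
    (hτ : τ ∈ Icc 0 T) :
    ‖p.1.1.ev τ‖ ^ 2 + |a| * pairTo τ (outflow T a p) (outflow T a p) =
      ‖p.1.1.ev 0‖ ^ 2 + |a| * pairTo τ (inflow T a p) (inflow T a p)
        + 2 * ∫ t in (0 : ℝ)..τ, inner ℝ (p.1.2.ev t) (p.1.1.ev t) := by
  have h := greenForm_eq_zero hp hp hτ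
  have e : ∫ t in (0 : ℝ)..τ,
      (inner ℝ (p.1.1.ev t) (p.1.2.ev t) + inner ℝ (p.1.2.ev t) (p.1.1.ev t))
      = 2 * ∫ t in (0 : ℝ)..τ, inner ℝ (p.1.2.ev t) (p.1.1.ev t) := by
    rw [← intervalIntegral.integral_const_mul]
    refine intervalIntegral.integral_congr fun t _ => ?_
    rw [real_inner_comm]; ring
  rw [greenForm, e, real_inner_self_eq_norm_sq, real_inner_self_eq_norm_sq] at h
  rcases lt_trichotomy a 0 with ha | rfl | ha
  · rw [outflow_of_neg ha, inflow_of_neg ha, abs_of_neg ha]; linarith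
  · simp at h ⊢; linarith
  · rw [outflow_of_pos ha, inflow_of_pos ha, abs_of_pos ha]; linarith

lemma two_integral_inner_le {τ : ℝ} (hτ : 0 ≤ τ) (f w : Curve T) :
    2 * ∫ t in (0 : ℝ)..τ, inner ℝ (f.ev t) (w.ev t) ≤
      ∫ t in (0 : ℝ)..τ, (‖f.ev t‖ ^ 2 + ‖w.ev t‖ ^ 2) := by
  rw [← intervalIntegral.integral_const_mul]
  refine intervalIntegral.integral_mono_on hτ (Continuous.intervalIntegrable (by fun_prop) _ _)
    (Continuous.intervalIntegrable (by fun_prop) _ _) fun t _ => ?_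
  nlinarith [real_inner_le_norm (f.ev t) (w.ev t), sq_nonneg (‖f.ev t‖ - ‖w.ev t‖)]

/-! ### Solvability of the transport problem -/

variable (T) in
/-- The data of a quadruple: initial value, inflow trace and source. -/
noncomputable def dataMap (a : ℝ) : Quad T →L[ℝ] (L2I × L2T T) × Curve T :=
  (((ContinuousMap.evalCLM ℝ ⟨0, zero_mem_Icc_time⟩).comp
      ((ContinuousLinearMap.fst ℝ _ _).comp (ContinuousLinearMap.fst ℝ _ _))).prod
    (inflow T a)).prod ((ContinuousLinearMap.snd ℝ _ _).comp (ContinuousLinearMap.fst ℝ _ _))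

lemma dataMap_apply (a : ℝ) (p : Quad T) :
    dataMap T a p = ((p.1.1.ev 0, inflow T a p), p.1.2) := by
  rw [Curve.ev_of_mem _ zero_mem_Icc_time]; rfl

lemma energy_le {a d : ℝ} {p : Quad T} (hp : p ∈ strongSolutions T a) (h0 : ‖p.1.1.ev 0‖ ≤ d)
    (hi : ‖inflow T a p‖ ≤ d) (hf : ‖p.1.2‖ ≤ d) {τ : ℝ} (hτ : τ ∈ Icc 0 T) :
    ‖p.1.1.ev τ‖ ^ 2 + |a| * pairTo τ (outflow T a p) (outflow T a p) ≤
      (1 + |a|) * d ^ 2 + 2 * T * d * ‖p.1.1‖ := by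
  have hd0 : 0 ≤ d := (norm_nonneg _).trans h0
  rw [energy_identity hp hτ]
  have h1 : ∫ t in (0 : ℝ)..τ, inner ℝ (p.1.2.ev t) (p.1.1.ev t) ≤ d * ‖p.1.1‖ * T := by
    calc _ ≤ ∫ t in (0 : ℝ)..τ, d * ‖p.1.1‖ := by
          refine intervalIntegral.integral_mono_on hτ.1
            (Continuous.intervalIntegrable (by fun_prop) _ _)
            (Continuous.intervalIntegrable (by fun_prop) _ _) fun t _ => ?_
          exact (real_inner_le_norm _ _).trans (mul_le_mul ((Curve.norm_ev_le _ _).trans hf)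
            (Curve.norm_ev_le _ _) (norm_nonneg _) hd0)
      _ = d * ‖p.1.1‖ * τ := by simp; ring
      _ ≤ d * ‖p.1.1‖ * T := mul_le_mul_of_nonneg_left hτ.2 (by positivity)
  have h2 : |a| * pairTo τ (inflow T a p) (inflow T a p) ≤ |a| * d ^ 2 :=
    mul_le_mul_of_nonneg_left ((pairTo_le _).trans (by gcongr)) (abs_nonneg a)
  have h3 : ‖p.1.1.ev 0‖ ^ 2 ≤ d ^ 2 := by gcongr
  linarith

lemma le_of_sq_le {α β d M : ℝ} (hα : 0 ≤ α) (hβ : 0 ≤ β) (hd : 0 ≤ d)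
    (h : M ^ 2 ≤ (1 + α) * d ^ 2 + β * d * M) : M ≤ (1 + α + β) * d := by
  by_contra! hlt
  have h1 : d ≤ (1 + α + β) * d := le_mul_of_one_le_left hd (by linarith)
  have hM : 0 < M := lt_of_le_of_lt (by positivity) hlt
  have h2 : (1 + α) * d * d ≤ (1 + α) * d * M := by gcongr; linarith
  have h3 : (1 + α + β) * d * M < M * M := by gcongr
  nlinarith

/-- Strong solutions are bounded by their data. -/
lemma exists_norm_le_dataMap {a : ℝ} (ha : a ≠ 0) :
    ∃ C : NNReal, ∀ p ∈ strongSolutions T a, ‖p‖ ≤ C * ‖dataMap T a p‖ := by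
  have ha' : 0 < |a| := abs_pos.2 ha
  have hT0 := hT.out
  obtain ⟨K, hK⟩ : ∃ K : ℝ, K = 1 + |a| + 2 * T := ⟨_, rfl⟩
  have hK1 : 1 ≤ K := by linarith
  have hK0 : 0 ≤ K / √|a| := by positivity
  refine ⟨NNReal.mk (K + K / √|a|) (by positivity), fun p hp => ?_⟩
  rw [NNReal.coe_mk, dataMap_apply]
  have hd' : ‖(p.1.1.ev 0, inflow T a p)‖ ≤ ‖((p.1.1.ev 0, inflow T a p), p.1.2)‖ :=
    norm_fst_le ((p.1.1.ev 0, inflow T a p), p.1.2)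
  have h0 := (norm_fst_le (p.1.1.ev 0, inflow T a p)).trans hd'
  have hi := (norm_snd_le (p.1.1.ev 0, inflow T a p)).trans hd'
  have hf := norm_snd_le ((p.1.1.ev 0, inflow T a p), p.1.2)
  have hd0 := norm_nonneg ((p.1.1.ev 0, inflow T a p), p.1.2)
  simp only at h0 hi hf
  generalize ‖((p.1.1.ev 0, inflow T a p), p.1.2)‖ = d at h0 hi hf hd0
  have hen := fun τ hτ => energy_le hp h0 hi hf (τ := τ) hτ
  have hM2 : ‖p.1.1‖ ^ 2 ≤ (1 + |a|) * d ^ 2 + 2 * T * d * ‖p.1.1‖ := by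
    have : ‖p.1.1‖ ≤ √((1 + |a|) * d ^ 2 + 2 * T * d * ‖p.1.1‖) := by
      refine (ContinuousMap.norm_le _ (Real.sqrt_nonneg _)).2 fun t => Real.le_sqrt_of_sq_le ?_
      have h1 := hen t t.2
      rw [Curve.ev_coe] at h1
      have h2 := mul_nonneg (abs_nonneg a) (pairTo_nonneg (τ := (t : ℝ)) (outflow T a p))
      linarith
    exact (Real.le_sqrt (norm_nonneg _) (by positivity)).1 this
  have hMK : ‖p.1.1‖ ≤ K * d := hK ▸ le_of_sq_le (abs_nonneg a) (by positivity) hd0 hM2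
  have ho : ‖outflow T a p‖ ≤ K / √|a| * d := by
    have h1 := hen T end_mem_Icc_time
    rw [pairTo_self_eq_inner, real_inner_self_eq_norm_sq] at h1
    have h2 : |a| * ‖outflow T a p‖ ^ 2 ≤ (K * d) ^ 2 := by
      have h3 : 2 * T * d * ‖p.1.1‖ ≤ 2 * T * d * (K * d) := by gcongr
      have h4 : (1 + |a|) * d ^ 2 ≤ (1 + |a|) * d ^ 2 * K :=
        le_mul_of_one_le_right (by positivity) hK1
      have h5 : (K * d) ^ 2 = (1 + |a|) * d ^ 2 * K + 2 * T * d * (K * d) := by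
        rw [hK]; ring
      linarith [sq_nonneg ‖p.1.1.ev T‖]
    have h3 : √|a| * ‖outflow T a p‖ ≤ K * d := by
      refine (abs_le_of_sq_le_sq' ?_ (by positivity)).2
      rwa [mul_pow, Real.sq_sqrt ha'.le]
    rwa [div_mul_eq_mul_div, le_div_iff₀ (by positivity), mul_comm]
  have hd1 : d ≤ (K + K / √|a|) * d := le_mul_of_one_le_left hd0 (by linarith)
  have hd2 : K * d ≤ (K + K / √|a|) * d := mul_le_mul_of_nonneg_right (by linarith) hd0
  have hd3 : K / √|a| * d ≤ (K + K / √|a|) * d := mul_le_mul_of_nonneg_right (by linarith) hd0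
  have hio : ‖p.2.1‖ ≤ (K + K / √|a|) * d ∧ ‖p.2.2‖ ≤ (K + K / √|a|) * d := by
    rcases lt_or_gt_of_ne ha with h | h
    · rw [inflow_of_neg h] at hi
      rw [outflow_of_neg h] at ho
      exact ⟨ho.trans hd3, hi.trans hd1⟩
    · rw [inflow_of_pos h] at hi
      rw [outflow_of_pos h] at ho
      exact ⟨hi.trans hd1, ho.trans hd3⟩
  exact norm_prod_le_iff.2 ⟨norm_prod_le_iff.2 ⟨hMK.trans hd2, hf.trans hd1⟩,
    norm_prod_le_iff.2 hio⟩

lemma isClosed_strongSolutions (a : ℝ) : IsClosed (strongSolutions T a : Set (Quad T)) :=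
  Submodule.isClosed_topologicalClosure _

variable (T) in
/-- The data for which the transport problem has a strong solution. -/
noncomputable def solvableData (a : ℝ) : Submodule ℝ ((L2I × L2T T) × Curve T) :=
  (strongSolutions T a).map (dataMap T a).toLinearMap

lemma isClosed_solvableData {a : ℝ} (ha : a ≠ 0) :
    IsClosed (solvableData T a : Set ((L2I × L2T T) × Curve T)) := by
  obtain ⟨C, hC⟩ := exists_norm_le_dataMap (T := T) ha
  have := (isClosed_strongSolutions (T := T) a).completeSpace_coe
  let D : strongSolutions T a →L[ℝ] (L2I × L2T T) × Curve T :=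
    (dataMap T a).comp (strongSolutions T a).subtypeL
  have hD : AntilipschitzWith C D :=
    AddMonoidHomClass.antilipschitz_of_bound D fun p => hC p p.2
  have h := hD.isClosed_range D.uniformContinuous
  change IsClosed (dataMap T a '' (strongSolutions T a : Set (Quad T)))
  rwa [image_eq_range]

lemma dataMap_mem_solvableData {a : ℝ} {φ φt φx : ℝ → ℝ → ℝ} {p : Quad T}
    (hp : Represents a φ φt φx p) : dataMap T a p ∈ solvableData T a :=
  Submodule.mem_map_of_mem (Submodule.le_topologicalClosure _ ⟨_, _, _, hp⟩)

/-- Sources of the form `tⁿ ψ(x)`, by induction on `n`: with `Ψ` a primitive of `ψ`, the function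
`tⁿ Ψ(x) / a` has source `tⁿ ψ(x)` up to a multiple of `tⁿ⁻¹ Ψ(x)`. -/
lemma exists_solvable_monomial {a : ℝ} (ha : a ≠ 0) (n : ℕ) {ψ : ℝ → ℝ} (hψ : Continuous ψ)
    {f : Curve T} (hf : ∀ t ∈ Icc 0 T,
      f.ev t =ᵐ[volume.restrict (Icc (0 : ℝ) 1)] fun x => t ^ n * ψ x) :
    ∃ d, (d, f) ∈ solvableData T a := by
  induction n generalizing ψ f with
  | zero =>
    have hΨ : ∀ x, HasDerivAt (fun x => ∫ y in (0 : ℝ)..x, ψ y) (ψ x) x := fun x =>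
      hψ.integral_hasStrictDerivAt 0 x |>.hasDerivAt
    have hΨc : Continuous fun x => ∫ y in (0 : ℝ)..x, ψ y :=
      continuous_iff_continuousAt.2 fun x => (hΨ x).continuousAt
    have hφ : IsTestFunction T (fun _ x => (∫ y in (0 : ℝ)..x, ψ y) / a) (fun _ _ => 0)
        (fun _ x => ψ x / a) :=
      { cont := by fun_prop
        cont_t := by fun_prop
        cont_x := by fun_prop
        deriv_t := fun _ _ _ _ => hasDerivWithinAt_const ..
        deriv_x := fun _ _ x _ => ((hΨ x).div_const a).hasDerivWithinAt }
    obtain ⟨p, hp⟩ := hφ.exists_represents a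
    refine ⟨(dataMap T a p).1, ?_⟩
    convert dataMap_mem_solvableData hp using 1
    rw [dataMap_apply]
    refine Prod.ext rfl (Curve.ext_ev fun t ht => Lp.ext ?_)
    filter_upwards [hf t ht, hp.source t ht] with x h1 h2
    rw [h1, h2]; field_simp; simp
  | succ n ih =>
    have hΨ : ∀ x, HasDerivAt (fun x => ∫ y in (0 : ℝ)..x, ψ y) (ψ x) x := fun x =>
      hψ.integral_hasStrictDerivAt 0 x |>.hasDerivAt
    have hΨc : Continuous fun x => ∫ y in (0 : ℝ)..x, ψ y :=
      continuous_iff_continuousAt.2 fun x => (hΨ x).continuousAt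
    have hφ : IsTestFunction T (fun t x => t ^ (n + 1) * ((∫ y in (0 : ℝ)..x, ψ y) / a))
        (fun t x => ((n + 1 : ℕ) * t ^ n) * ((∫ y in (0 : ℝ)..x, ψ y) / a))
        (fun t x => t ^ (n + 1) * (ψ x / a)) :=
      { cont := by fun_prop
        cont_t := by fun_prop
        cont_x := by fun_prop
        deriv_t := fun t _ _ _ => ((hasDerivAt_pow (n + 1) t).mul_const _).hasDerivWithinAt
        deriv_x := fun _ _ x _ => (((hΨ x).div_const a).const_mul _).hasDerivWithinAt }
    obtain ⟨p, hp⟩ := hφ.exists_represents a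
    obtain ⟨f', hf'⟩ := exists_curve (T := T) (θ := fun t x => t ^ n * ∫ y in (0 : ℝ)..x, ψ y)
      (by fun_prop)
    obtain ⟨d', hd'⟩ := ih hΨc hf'
    refine ⟨(dataMap T a p).1 - ((n + 1 : ℕ) / a : ℝ) • d', ?_⟩
    convert Submodule.sub_mem _ (dataMap_mem_solvableData hp)
      (Submodule.smul_mem _ ((n + 1 : ℕ) / a : ℝ) hd') using 1
    rw [dataMap_apply]
    refine Prod.ext rfl (Curve.ext_ev fun t ht => Lp.ext ?_)
    change _ =ᵐ[_] (p.1.2.ev t - ((n + 1 : ℕ) / a : ℝ) • f'.ev t : L2I)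
    filter_upwards [hf t ht, hp.source t ht, hf' t ht,
      Lp.coeFn_sub (p.1.2.ev t) (((n + 1 : ℕ) / a : ℝ) • f'.ev t),
      Lp.coeFn_smul ((n + 1 : ℕ) / a : ℝ) (f'.ev t)] with x h1 h2 h3 h4 h5
    rw [h4, Pi.sub_apply, h5, Pi.smul_apply, h1, h2, h3, smul_eq_mul]
    field_simp; ring

end

/-- The affine change of variables `t ↦ b - a t` acts on square-integrable functions with a
constant Jacobian. -/
lemma eLpNorm_comp_affine {a : ℝ} (ha : a ≠ 0) (b : ℝ) {F : ℝ → ℝ}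
    (hF : AEStronglyMeasurable F volume) :
    AEStronglyMeasurable (fun t => F (b - a * t)) volume ∧
    eLpNorm (fun t => F (b - a * t)) 2 volume =
      ENNReal.ofReal |a⁻¹| ^ (1 / 2 : ℝ) * eLpNorm F 2 volume := by
  have hmeas : Measurable fun t : ℝ => b - a * t := by fun_prop
  have hmap : Measure.map (fun t : ℝ => b - a * t) volume = ENNReal.ofReal |a⁻¹| • volume := by
    have h1 : (fun t : ℝ => b - a * t) = (fun s => b - s) ∘ (fun t => a * t) := rfl
    rw [h1, ← Measure.map_map (by fun_prop) (by fun_prop), Real.map_volume_mul_left ha,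
      Measure.map_smul, (Measure.measurePreserving_sub_left volume b).map_eq]
  have hF' : AEStronglyMeasurable F (Measure.map (fun t : ℝ => b - a * t) volume) := by
    rw [hmap]; exact hF.smul_measure _
  refine ⟨hF'.comp_measurable hmeas, ?_⟩
  have h := eLpNorm_map_measure (p := 2) hF' hmeas.aemeasurable
  rw [hmap, eLpNorm_smul_measure_of_ne_top (by simp)] at h
  simpa [Function.comp_def] using h.symm

section
variable {T : ℝ} [hT : Fact (0 < T)]

/-- Any initial value and inflow trace can be prescribed when the source vanishes: extend the
initial value across the inflow boundary by the trace, follow the characteristics, and approximate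
the resulting profile by smooth functions. -/
lemma solvable_homogeneous {a : ℝ} (ha : a ≠ 0) (w₀ : L2I) (g : L2T T) :
    ((w₀, g), (0 : Curve T)) ∈ solvableData T a := by
  set b : ℝ := if 0 < a then 0 else 1 with hb
  -- for positive times, the characteristic through the inflow boundary starts outside `[0,1]`
  have hout : ∀ t, 0 < t → b - a * t ∉ Icc (0 : ℝ) 1 := by
    rintro t ht ⟨h1, h2⟩
    rcases lt_or_gt_of_ne ha with h | h
    · rw [hb, if_neg h.le.not_gt] at h2
      nlinarith
    · rw [hb, if_pos h] at h1
      nlinarith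
  set G : ℝ → ℝ := (Icc 0 T).indicator g with hG
  have hGm : MemLp G 2 volume := (memLp_indicator_iff_restrict measurableSet_Icc).2 (Lp.memLp g)
  set E : ℝ → ℝ := fun y => G (b / a - a⁻¹ * y) with hE
  have hEm : MemLp E 2 volume := by
    obtain ⟨h1, h2⟩ := eLpNorm_comp_affine (inv_ne_zero ha) (b / a) hGm.1
    refine ⟨h1, ?_⟩
    rw [h2]
    exact ENNReal.mul_lt_top (by simp [ENNReal.rpow_lt_top_of_nonneg]) hGm.2
  set h : ℝ → ℝ := (Icc (0 : ℝ) 1).indicator w₀ + (Icc (0 : ℝ) 1)ᶜ.indicator E with hh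
  have hhm : MemLp h 2 volume :=
    ((memLp_indicator_iff_restrict measurableSet_Icc).2 (Lp.memLp w₀)).add
      (hEm.indicator measurableSet_Icc.compl)
  have hh0 : ∀ x ∈ Icc (0 : ℝ) 1, h x = w₀ x := fun x hx => by simp [hh, hx]
  have hhb : ∀ t, 0 < t → t ≤ T → h (b - a * t) = g t := fun t h0 h1 => by
    have h2 := hout t h0
    have h3 : b / a - a⁻¹ * (b - a * t) = t := by field_simp; ring
    rw [hh, Pi.add_apply, indicator_of_notMem h2, indicator_of_mem (mem_compl h2), hE]
    simp only [h3, hG, zero_add]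
    exact indicator_of_mem (mem_Icc.2 ⟨h0.le, h1⟩) _
  refine (isClosed_solvableData ha).closure_subset_iff.2 subset_rfl ?_
  rw [Metric.mem_closure_iff]
  intro ε hε
  set c : ℝ := 1 + |a⁻¹| with hc
  have hc0 : 1 ≤ c := by rw [hc]; linarith [abs_nonneg a⁻¹]
  obtain ⟨ψ, -, hψ, hle⟩ := hhm.exist_eLpNorm_sub_le (by simp) (by norm_num)
    (ε := ε / (2 * c)) (by positivity)
  have hψd : ∀ x, HasDerivAt ψ (deriv ψ x) x := fun x =>
    (hψ.differentiable (by simp) x).hasDerivAt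
  have hψ' : Continuous (deriv ψ) := hψ.continuous_deriv (by simp)
  have hψc : Continuous ψ := hψ.continuous
  have hφ : IsTestFunction T (fun t x => ψ (x - a * t)) (fun t x => deriv ψ (x - a * t) * -a)
      (fun t x => deriv ψ (x - a * t)) :=
    { cont := by fun_prop
      cont_t := by fun_prop
      cont_x := by fun_prop
      deriv_t := fun t _ x _ => by
        have h1 : HasDerivAt (fun s => x - a * s) (-a) t := by
          simpa using ((hasDerivAt_id t).const_mul a).const_sub x
        exact ((hψd (x - a * t)).comp t h1).hasDerivWithinAt
      deriv_x := fun t _ x _ => by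
        have h1 : HasDerivAt (fun y => y - a * t) 1 x := (hasDerivAt_id x).sub_const _
        exact (((hψd (x - a * t)).comp x h1).congr_deriv (mul_one _)).hasDerivWithinAt }
  obtain ⟨p, hp⟩ := hφ.exists_represents a
  refine ⟨_, dataMap_mem_solvableData hp, ?_⟩
  rw [dataMap_apply]
  have hsrc : p.1.2 = 0 := Curve.ext_ev fun t ht => Lp.ext <| by
    filter_upwards [hp.source t ht, Lp.coeFn_zero ℝ 2 (volume.restrict (Icc (0 : ℝ) 1))]
      with x h1 h2
    rw [h1, Curve.ev_zero, h2, Pi.zero_apply]; ring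
  have hin : inflow T a p =ᵐ[volume.restrict (Icc 0 T)] fun t => ψ (b - a * t) := by
    rcases lt_or_gt_of_ne ha with h | h
    · rw [inflow_of_neg h, hb, if_neg h.le.not_gt]; exact hp.right
    · rw [inflow_of_pos h, hb, if_pos h]; exact hp.left
  have hδ : 0 ≤ ε / (2 * c) := by positivity
  have hε2 : ε / (2 * c) * c = ε / 2 := by field_simp
  have h1 : dist w₀ (p.1.1.ev 0) ≤ ε / 2 := by
    rw [Lp.dist_def]
    refine ENNReal.toReal_le_of_le_ofReal (by positivity) ?_
    calc eLpNorm (w₀ - p.1.1.ev 0 : ℝ → ℝ) 2 (volume.restrict (Icc 0 1))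
        = eLpNorm (h - ψ) 2 (volume.restrict (Icc 0 1)) := by
          refine eLpNorm_congr_ae ?_
          filter_upwards [hp.state 0 zero_mem_Icc_time, ae_restrict_mem measurableSet_Icc]
            with x h1 hx
          rw [Pi.sub_apply, Pi.sub_apply, h1, hh0 x hx]; simp
      _ ≤ eLpNorm (h - ψ) 2 volume := eLpNorm_mono_measure _ Measure.restrict_le_self
      _ ≤ _ := hle.trans (ENNReal.ofReal_le_ofReal (by nlinarith))
  have h2 : dist g (inflow T a p) ≤ ε / 2 := by
    rw [Lp.dist_def]
    refine ENNReal.toReal_le_of_le_ofReal (by positivity) ?_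
    calc eLpNorm (g - inflow T a p : ℝ → ℝ) 2 (volume.restrict (Icc 0 T))
        = eLpNorm (fun t => (h - ψ) (b - a * t)) 2 (volume.restrict (Icc 0 T)) := by
          refine eLpNorm_congr_ae ?_
          have h0 : ∀ᵐ t ∂(volume.restrict (Icc 0 T)), t ≠ (0 : ℝ) :=
            ae_restrict_of_ae (by simp [ae_iff])
          filter_upwards [hin, ae_restrict_mem measurableSet_Icc, h0] with t h1 ht h0
          rw [Pi.sub_apply, Pi.sub_apply, h1, hhb t (lt_of_le_of_ne ht.1 h0.symm) ht.2]
      _ ≤ eLpNorm (fun t => (h - ψ) (b - a * t)) 2 volume :=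
          eLpNorm_mono_measure _ Measure.restrict_le_self
      _ = ENNReal.ofReal |a⁻¹| ^ (1 / 2 : ℝ) * eLpNorm (h - ψ) 2 volume :=
          (eLpNorm_comp_affine ha b (hhm.1.sub hψc.aestronglyMeasurable)).2
      _ ≤ ENNReal.ofReal c * ENNReal.ofReal (ε / (2 * c)) := by
          gcongr
          rw [ENNReal.ofReal_rpow_of_nonneg (abs_nonneg _) (by norm_num)]
          refine ENNReal.ofReal_le_ofReal ?_
          rw [← Real.sqrt_eq_rpow, Real.sqrt_le_left (by linarith)]
          rw [hc]; nlinarith [abs_nonneg a⁻¹]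
      _ = ENNReal.ofReal (ε / 2) := by
          rw [← ENNReal.ofReal_mul (by positivity), mul_comm c, hε2]
  rw [Prod.dist_eq, Prod.dist_eq, hsrc, dist_self, max_eq_left (by positivity)]
  exact (max_le h1 h2).trans_lt (by linarith)

/-- Any continuous source can be prescribed. By linearity and closedness it suffices to treat
`tⁿ ψ(x)`, thanks to Bernstein's approximation of curves and the density of continuous functions
in `L²`. -/
lemma solvable_source {a : ℝ} (ha : a ≠ 0) (f : Curve T) :
    ((0, 0), f) ∈ solvableData T a := by
  let F : Submodule ℝ (Curve T) :=
    (solvableData T a).comap (LinearMap.inr ℝ (L2I × L2T T) (Curve T))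
  have hF : IsClosed (F : Set (Curve T)) :=
    (isClosed_solvableData ha).preimage (f := fun f => ((0 : L2I × L2T T), f)) (by fun_prop)
  have hFmem : ∀ {f : Curve T}, (∃ d, (d, f) ∈ solvableData T a) → f ∈ F := by
    rintro f ⟨⟨w₀, g⟩, h⟩
    have := Submodule.sub_mem _ h (solvable_homogeneous ha w₀ g)
    simpa [F] using this
  let mono : ℕ → L2I → Curve T := fun n e =>
    ⟨fun t => (t : ℝ) ^ n • e, by fun_prop⟩
  have hmono : ∀ n e, mono n e ∈ F := by
    intro n e
    have hc : Continuous (mono n) :=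
      ContinuousMap.continuous_of_continuous_uncurry _ (by
        change Continuous fun z : L2I × Icc (0 : ℝ) T => ((z.2 : ℝ) ^ n • z.1)
        fun_prop)
    refine (hF.preimage hc).closure_subset_iff.2 ?_
      (BoundedContinuousFunction.toLp_denseRange ℝ _ ℝ (by simp) e)
    rintro _ ⟨ψ, rfl⟩
    refine hFmem (exists_solvable_monomial ha n ψ.continuous fun t ht => ?_)
    rw [Curve.ev_of_mem _ ht]
    filter_upwards [Lp.coeFn_smul (t ^ n) (BoundedContinuousFunction.toLp 2
      (volume.restrict (Icc (0 : ℝ) 1)) ℝ ψ), BoundedContinuousFunction.coeFn_toLp (p := 2)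
      (μ := volume.restrict (Icc (0 : ℝ) 1)) (𝕜 := ℝ) ψ] with x h1 h2
    exact h1.trans (by rw [Pi.smul_apply, h2, smul_eq_mul])
  let poly : Polynomial ℝ → L2I → Curve T := fun P e =>
    ⟨fun t => P.eval (t : ℝ) • e, by fun_prop⟩
  have hpoly : ∀ P e, poly P e ∈ F := by
    intro P e
    induction P using Polynomial.induction_on' with
    | add P Q hP hQ =>
      convert F.add_mem hP hQ using 1
      ext1 t
      simp [poly, add_smul]
    | monomial n c =>
      convert F.smul_mem c (hmono n e) using 1
      ext1 t
      simp [poly, mono, mul_smul]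
  let σ : C(Icc (0 : ℝ) 1, Icc (0 : ℝ) T) :=
    ⟨fun s => ⟨T * s, mul_nonneg hT.out.le s.2.1, mul_le_of_le_one_right hT.out.le s.2.2⟩,
      by fun_prop⟩
  let ρ : C(Icc (0 : ℝ) T, Icc (0 : ℝ) 1) :=
    ⟨fun t => ⟨t / T, div_nonneg t.2.1 hT.out.le, (div_le_one hT.out).2 t.2.2⟩, by fun_prop⟩
  have hσρ : (f.comp σ).comp ρ = f := by
    ext1 t
    simp only [ContinuousMap.comp_apply]
    congr 1
    exact Subtype.ext (mul_div_cancel₀ _ hT.out.ne')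
  have hlim := ((ContinuousMap.continuous_precomp ρ).tendsto _).comp
    (bernsteinApproximation_uniform (f.comp σ))
  rw [hσρ] at hlim
  refine hF.mem_of_tendsto hlim (.of_forall fun n => ?_)
  have : (bernsteinApproximation n (f.comp σ)).comp ρ = ∑ k : Fin (n + 1),
      poly ((bernsteinPolynomial ℝ n k).comp (Polynomial.C T⁻¹ * Polynomial.X))
        (f (σ (bernstein.z k))) := by
    ext1 t
    simp [bernsteinApproximation, poly, bernstein, ρ, div_eq_inv_mul]
  simp only [Function.comp_apply]
  rw [this]
  exact F.sum_mem fun k _ => hpoly _ _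

lemma mem_solvableData {a : ℝ} (ha : a ≠ 0) (w₀ : L2I) (g : L2T T) (f : Curve T) :
    ((w₀, g), f) ∈ solvableData T a := by
  have e : ((w₀, g), f) = ((w₀, g), (0 : Curve T)) + (((0 : L2I), (0 : L2T T)), f) :=
    Prod.ext (Prod.ext (add_zero _).symm (add_zero _).symm) (zero_add _).symm
  rw [e]
  exact Submodule.add_mem _ (solvable_homogeneous ha w₀ g) (solvable_source ha f)

lemma exists_strongSolution_of_pos {a : ℝ} (ha : 0 < a) (w₀ : L2I) (g : L2T T) (f : Curve T) :
    ∃ p ∈ strongSolutions T a, p.1.1.ev 0 = w₀ ∧ p.2.1 = g ∧ p.1.2 = f := by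
  obtain ⟨p, hp, h⟩ := mem_solvableData ha.ne' w₀ g f
  have h' : ((p.1.1.ev 0, p.2.1), p.1.2) = ((w₀, g), f) := by
    rw [← inflow_of_pos ha, ← dataMap_apply]; exact h
  simp only [Prod.mk.injEq] at h'
  exact ⟨p, hp, h'.1.1, h'.1.2, h'.2⟩

lemma exists_strongSolution_of_neg {a : ℝ} (ha : a < 0) (w₀ : L2I) (g : L2T T) (f : Curve T) :
    ∃ p ∈ strongSolutions T a, p.1.1.ev 0 = w₀ ∧ p.2.2 = g ∧ p.1.2 = f := by
  obtain ⟨p, hp, h⟩ := mem_solvableData ha.ne w₀ g f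
  have h' : ((p.1.1.ev 0, p.2.2), p.1.2) = ((w₀, g), f) := by
    rw [← inflow_of_neg ha, ← dataMap_apply]; exact h
  simp only [Prod.mk.injEq] at h'
  exact ⟨p, hp, h'.1.1, h'.1.2, h'.2⟩

end

section
variable {T : ℝ} [hT : Fact (0 < T)]

/-! ### The coupled system -/

/-- The pointwise action of a bounded operator on curves. -/
noncomputable def Curve.map (A : L2I →L[ℝ] L2I) (w : Curve T) : Curve T :=
  ⟨fun t => A (w t), A.continuous.comp w.continuous⟩

@[simp] lemma Curve.ev_map (A : L2I →L[ℝ] L2I) (w : Curve T) (t : ℝ) :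
    (w.map A).ev t = A (w.ev t) := rfl

/-- Energy estimate for a pair of transport equations with opposite speeds, coupled at `x = 0`,
with vanishing initial values and vanishing inflow at `x = 1`. The weight `m` makes the boundary
terms at `x = 0` cancel. -/
lemma coupled_energy_le {a b q m : ℝ} (ha : 0 < a) (hb : 0 < b) (hm : b * m = a * q ^ 2)
    (hm0 : 0 < m) {p r : Quad T} (hp : p ∈ strongSolutions T a) (hr : r ∈ strongSolutions T (-b))
    (hp0 : p.1.1.ev 0 = 0) (hr0 : r.1.1.ev 0 = 0) (hpr : p.2.1 = q • r.2.1) (hr1 : r.2.2 = 0)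
    {τ : ℝ} (hτ : τ ∈ Icc 0 T) :
    ‖p.1.1.ev τ‖ ^ 2 + m * ‖r.1.1.ev τ‖ ^ 2 ≤
      ∫ t in (0 : ℝ)..τ, ((‖p.1.2.ev t‖ ^ 2 + m * ‖r.1.2.ev t‖ ^ 2)
        + (‖p.1.1.ev t‖ ^ 2 + m * ‖r.1.1.ev t‖ ^ 2)) := by
  have hb' : -b < 0 := by linarith
  have e1 := energy_identity hp hτ
  have e2 := energy_identity hr hτ
  have i1 := two_integral_inner_le hτ.1 p.1.2 p.1.1
  have i2 := two_integral_inner_le hτ.1 r.1.2 r.1.1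
  rw [inflow_of_pos ha, outflow_of_pos ha, hp0, hpr, pairTo_smul_smul, abs_of_pos ha] at e1
  rw [inflow_of_neg hb', outflow_of_neg hb', hr0, hr1, abs_of_neg hb', neg_neg] at e2
  have z : pairTo τ (0 : L2T T) 0 = 0 := by simp [pairTo]
  rw [z] at e2
  have hnn := mul_nonneg ha.le (pairTo_nonneg (τ := τ) p.2.2)
  have hsum : (∫ t in (0 : ℝ)..τ, ((‖p.1.2.ev t‖ ^ 2 + m * ‖r.1.2.ev t‖ ^ 2)
      + (‖p.1.1.ev t‖ ^ 2 + m * ‖r.1.1.ev t‖ ^ 2))) =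
      (∫ t in (0 : ℝ)..τ, (‖p.1.2.ev t‖ ^ 2 + ‖p.1.1.ev t‖ ^ 2))
        + m * ∫ t in (0 : ℝ)..τ, (‖r.1.2.ev t‖ ^ 2 + ‖r.1.1.ev t‖ ^ 2) := by
    rw [← intervalIntegral.integral_const_mul, ← intervalIntegral.integral_add
      (Continuous.intervalIntegrable (by fun_prop) _ _)
      (Continuous.intervalIntegrable (by fun_prop) _ _)]
    refine intervalIntegral.integral_congr fun t _ => ?_
    ring
  have e3 : m * ‖r.1.1.ev τ‖ ^ 2 + a * (q ^ 2 * pairTo τ r.2.1 r.2.1) =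
      m * (2 * ∫ t in (0 : ℝ)..τ, inner ℝ (r.1.2.ev t) (r.1.1.ev t)) := by
    rw [← mul_assoc, ← hm]
    simp only [norm_zero] at e2
    linear_combination m * e2
  have i3 := mul_le_mul_of_nonneg_left i2 hm0.le
  rw [hsum]
  simp only [norm_zero] at e1
  linarith

/-- A Volterra inequality in the norm weighted by `exp (κ t)`, which gains a factor `1 / 2`. -/
lemma le_half_mul_exp_of_le_integral {e e' : ℝ → ℝ} {C N : ℝ} (he : Continuous e)
    (he' : Continuous e') (he'0 : ∀ t, 0 ≤ e' t) (hC : 0 ≤ C) (hN : 0 ≤ N)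
    (hle : ∀ t ∈ Icc 0 T, e t ≤ N * Real.exp ((2 + 2 * C) * t))
    (hint : ∀ τ ∈ Icc 0 T, e' τ ≤ ∫ t in (0 : ℝ)..τ, (C * e t + e' t)) :
    ∀ t ∈ Icc 0 T, e' t ≤ N / 2 * Real.exp ((2 + 2 * C) * t) := by
  set κ := 2 + 2 * C with hκ
  have hκ0 : 0 < κ := by linarith
  obtain ⟨s, hs, hmax⟩ := isCompact_Icc.exists_isMaxOn ⟨0, zero_mem_Icc_time (T := T)⟩
    (f := fun t => e' t * Real.exp (-(κ * t))) (by fun_prop)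
  set N' := e' s * Real.exp (-(κ * s)) with hN'
  have hN'0 : 0 ≤ N' := mul_nonneg (he'0 s) (Real.exp_pos _).le
  have hle' : ∀ t ∈ Icc 0 T, e' t ≤ N' * Real.exp (κ * t) := fun t ht => by
    have h1 : e' t * Real.exp (-(κ * t)) ≤ N' := hmax ht
    rwa [Real.exp_neg, ← div_eq_mul_inv, div_le_iff₀ (Real.exp_pos _)] at h1
  have hs' : e' s = N' * Real.exp (κ * s) := by
    rw [hN', mul_assoc, ← Real.exp_add]; simp
  have h1 : N' * Real.exp (κ * s) ≤ (C * N + N') * (Real.exp (κ * s) / κ) := by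
    calc N' * Real.exp (κ * s) = e' s := hs'.symm
      _ ≤ ∫ t in (0 : ℝ)..s, (C * e t + e' t) := hint s hs
      _ ≤ ∫ t in (0 : ℝ)..s, (C * N + N') * Real.exp (κ * t) := by
        refine intervalIntegral.integral_mono_on hs.1
          (Continuous.intervalIntegrable (by fun_prop) _ _)
          (Continuous.intervalIntegrable (by fun_prop) _ _) fun t ht => ?_
        have ht' : t ∈ Icc 0 T := ⟨ht.1, ht.2.trans hs.2⟩
        have := mul_le_mul_of_nonneg_left (hle t ht') hC
        linarith [hle' t ht']
      _ = (C * N + N') * ((Real.exp (κ * s) - 1) / κ) := by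
        rw [intervalIntegral.integral_const_mul]
        congr 1
        have hd : ∀ t ∈ uIcc 0 s,
            HasDerivAt (fun t => Real.exp (κ * t) / κ) (Real.exp (κ * t)) t := by
          intro t _
          have := (((hasDerivAt_id t).const_mul κ).exp).div_const κ
          refine this.congr_deriv ?_
          simp only [id]; field_simp
        rw [intervalIntegral.integral_eq_sub_of_hasDerivAt hd
          (Continuous.intervalIntegrable (by fun_prop) _ _)]
        simp [sub_div]
      _ ≤ _ := by gcongr; linarith
  have h2 : N' ≤ N / 2 := by
    have h3 : N' * κ ≤ C * N + N' := by
      rw [mul_div_assoc', le_div_iff₀ hκ0] at h1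
      have := Real.exp_pos (κ * s)
      by_contra! h4
      nlinarith [mul_lt_mul_of_pos_right h4 this]
    have h5 : N' * (1 + 2 * C) ≤ N / 2 * (1 + 2 * C) := by rw [hκ] at h3; linarith
    exact le_of_mul_le_mul_right h5 (by linarith)
  exact fun t ht => (hle' t ht).trans (by gcongr)

/-- A map on pairs of curves that gains a factor `1 / 2` in the weighted energy norm has a fixed
point, because some iterate of it is a contraction in the supremum norm. -/
lemma exists_fixedPoint_of_half {m κ : ℝ} (hm0 : 0 < m) (hκ : 0 ≤ κ)
    (Γ : Curve T × Curve T → Curve T × Curve T)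
    (step : ∀ z z' : Curve T × Curve T, ∀ N, 0 ≤ N →
      (∀ t ∈ Icc 0 T, ‖(z.1 - z'.1).ev t‖ ^ 2 + m * ‖(z.2 - z'.2).ev t‖ ^ 2 ≤
        N * Real.exp (κ * t)) →
      ∀ t ∈ Icc 0 T, ‖((Γ z).1 - (Γ z').1).ev t‖ ^ 2 + m * ‖((Γ z).2 - (Γ z').2).ev t‖ ^ 2 ≤
        N / 2 * Real.exp (κ * t)) :
    ∃ z, Γ z = z := by
  have iter : ∀ n : ℕ, ∀ z z' : Curve T × Curve T, ∀ t ∈ Icc 0 T,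
      ‖((Γ^[n] z).1 - (Γ^[n] z').1).ev t‖ ^ 2 + m * ‖((Γ^[n] z).2 - (Γ^[n] z').2).ev t‖ ^ 2 ≤
        (1 + m) * ‖z - z'‖ ^ 2 / 2 ^ n * Real.exp (κ * t) := by
    intro n z z'
    induction n with
    | zero =>
      intro t ht
      have h1 : ‖(z.1 - z'.1).ev t‖ ≤ ‖z - z'‖ :=
        (Curve.norm_ev_le _ _).trans (norm_fst_le (z - z'))
      have h2 : ‖(z.2 - z'.2).ev t‖ ≤ ‖z - z'‖ :=
        (Curve.norm_ev_le _ _).trans (norm_snd_le (z - z'))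
      have h3 : 1 ≤ Real.exp (κ * t) :=
        Real.one_le_exp (mul_nonneg hκ ht.1)
      calc _ ≤ ‖z - z'‖ ^ 2 + m * ‖z - z'‖ ^ 2 := by
            simp only [Function.iterate_zero, id]; gcongr
        _ = (1 + m) * ‖z - z'‖ ^ 2 / 2 ^ 0 := by simp; ring
        _ ≤ _ := le_mul_of_one_le_right (by positivity) h3
    | succ n ih =>
      have h := step _ _ _ (by positivity) ih
      simp only [Function.iterate_succ_apply']
      rwa [div_div, ← pow_succ] at h
  obtain ⟨n, hn⟩ := pow_unbounded_of_one_lt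
    (4 * ((1 + m⁻¹) * ((1 + m) * Real.exp (κ * T)))) (one_lt_two (α := ℝ))
  have hcontr : ContractingWith (1 / 2) (Γ^[n]) := by
    refine ⟨by norm_num, LipschitzWith.of_dist_le_mul fun z z' => ?_⟩
    rw [dist_eq_norm, dist_eq_norm]
    have hE : ∀ t ∈ Icc 0 T, (1 + m) * ‖z - z'‖ ^ 2 / 2 ^ n * Real.exp (κ * t) * (1 + m⁻¹)
        ≤ (1 / 2 * ‖z - z'‖) ^ 2 := by
      intro t ht
      have h1 : Real.exp (κ * t) ≤ Real.exp (κ * T) :=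
        Real.exp_le_exp.2 (mul_le_mul_of_nonneg_left ht.2 hκ)
      calc _ ≤ (1 + m) * ‖z - z'‖ ^ 2 / 2 ^ n * Real.exp (κ * T) * (1 + m⁻¹) := by gcongr
        _ = ((1 + m⁻¹) * ((1 + m) * Real.exp (κ * T))) / 2 ^ n * ‖z - z'‖ ^ 2 := by ring
        _ ≤ 1 / 4 * ‖z - z'‖ ^ 2 := by
          refine mul_le_mul_of_nonneg_right ?_ (sq_nonneg _)
          rw [div_le_iff₀ (by positivity)]
          linarith
        _ = _ := by ring
    have hinv : 0 < m⁻¹ := inv_pos.2 hm0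
    have hcomp : ∀ t ∈ Icc 0 T, ‖((Γ^[n] z).1 - (Γ^[n] z').1).ev t‖ ≤ 1 / 2 * ‖z - z'‖ ∧
        ‖((Γ^[n] z).2 - (Γ^[n] z').2).ev t‖ ≤ 1 / 2 * ‖z - z'‖ := by
      intro t ht
      have h1 := iter n z z' t ht
      have h2 := hE t ht
      generalize (1 + m) * ‖z - z'‖ ^ 2 / 2 ^ n * Real.exp (κ * t) = E at h1 h2
      have x2 := sq_nonneg ‖((Γ^[n] z).1 - (Γ^[n] z').1).ev t‖
      have y2 := sq_nonneg ‖((Γ^[n] z).2 - (Γ^[n] z').2).ev t‖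
      have hE0 : 0 ≤ E := by nlinarith
      constructor
      · refine (abs_le_of_sq_le_sq' ?_ (by positivity)).2
        nlinarith
      · refine (abs_le_of_sq_le_sq' ?_ (by positivity)).2
        have h3 := mul_le_mul_of_nonneg_right h1 hinv.le
        have h4 : m * ‖((Γ^[n] z).2 - (Γ^[n] z').2).ev t‖ ^ 2 * m⁻¹ =
          ‖((Γ^[n] z).2 - (Γ^[n] z').2).ev t‖ ^ 2 := by field_simp
        nlinarith
    have hnn : 0 ≤ 1 / 2 * ‖z - z'‖ := by positivity
    have hhalf : ((1 / 2 : NNReal) : ℝ) = 1 / 2 := by norm_num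
    rw [hhalf]
    refine norm_prod_le_iff.2 ⟨(ContinuousMap.norm_le _ hnn).2 fun t => ?_,
      (ContinuousMap.norm_le _ hnn).2 fun t => ?_⟩
    · have := (hcomp t t.2).1
      rwa [Curve.ev_coe] at this
    · have := (hcomp t t.2).2
      rwa [Curve.ev_coe] at this
  exact ⟨_, hcontr.isFixedPt_fixedPoint_iterate⟩

/-- One step of the fixed point iteration: solving the two transport equations with coupling
sources `A v` and `B u` gains a factor `1 / 2` in the weighted energy norm. -/
lemma coupled_energy_half {a b q m C N : ℝ} (ha : 0 < a) (hb : 0 < b) (hm : b * m = a * q ^ 2)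
    (hm0 : 0 < m) {A B : L2I →L[ℝ] L2I} (hC : C = ‖A‖ ^ 2 / m + m * ‖B‖ ^ 2) {p r : Quad T}
    (hp : p ∈ strongSolutions T a) (hr : r ∈ strongSolutions T (-b))
    (hp0 : p.1.1.ev 0 = 0) (hr0 : r.1.1.ev 0 = 0) (hpr : p.2.1 = q • r.2.1) (hr1 : r.2.2 = 0)
    {u v : Curve T} (hpu : p.1.2 = v.map A) (hrv : r.1.2 = u.map B) (hN : 0 ≤ N)
    (hle : ∀ t ∈ Icc 0 T, ‖u.ev t‖ ^ 2 + m * ‖v.ev t‖ ^ 2 ≤ N * Real.exp ((2 + 2 * C) * t)) :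
    ∀ t ∈ Icc 0 T, ‖p.1.1.ev t‖ ^ 2 + m * ‖r.1.1.ev t‖ ^ 2 ≤
      N / 2 * Real.exp ((2 + 2 * C) * t) := by
  have hC0 : 0 ≤ C := by rw [hC]; positivity
  refine le_half_mul_exp_of_le_integral (e := fun t => ‖u.ev t‖ ^ 2 + m * ‖v.ev t‖ ^ 2)
    (e' := fun t => ‖p.1.1.ev t‖ ^ 2 + m * ‖r.1.1.ev t‖ ^ 2)
    (by fun_prop) (by fun_prop) (fun t => by positivity) hC0 hN hle fun τ hτ => ?_
  refine (coupled_energy_le ha hb hm hm0 hp hr hp0 hr0 hpr hr1 hτ).trans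
    (intervalIntegral.integral_mono_on hτ.1 (Continuous.intervalIntegrable (by fun_prop) _ _)
      (Continuous.intervalIntegrable (by fun_prop) _ _) fun t _ => add_le_add ?_ le_rfl)
  rw [hpu, hrv, Curve.ev_map, Curve.ev_map]
  have b1 : ‖A (v.ev t)‖ ^ 2 ≤ ‖A‖ ^ 2 * ‖v.ev t‖ ^ 2 := by
    rw [← mul_pow]; gcongr; exact A.le_opNorm _
  have b2 : ‖B (u.ev t)‖ ^ 2 ≤ ‖B‖ ^ 2 * ‖u.ev t‖ ^ 2 := by
    rw [← mul_pow]; gcongr; exact B.le_opNorm _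
  calc _ ≤ ‖A‖ ^ 2 * ‖v.ev t‖ ^ 2 + m * (‖B‖ ^ 2 * ‖u.ev t‖ ^ 2) := by gcongr
    _ = ‖A‖ ^ 2 / m * (m * ‖v.ev t‖ ^ 2) + m * ‖B‖ ^ 2 * ‖u.ev t‖ ^ 2 := by field_simp
    _ ≤ C * (‖u.ev t‖ ^ 2 + m * ‖v.ev t‖ ^ 2) := by
      have c1 : 0 ≤ ‖A‖ ^ 2 / m * ‖u.ev t‖ ^ 2 := by positivity
      have c2 : 0 ≤ m * ‖B‖ ^ 2 * (m * ‖v.ev t‖ ^ 2) := by positivity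
      rw [hC]; linarith

/-- Well-posedness of the boundary controlled system, with bounded coupling operators, sources and
a boundary control. The solution is a fixed point of the map that solves the two uncoupled
transport equations, some iterate of which is a contraction. -/
lemma exists_coupled_solution {a b q : ℝ} (ha : 0 < a) (hb : 0 < b) (hq : q ≠ 0)
    (A B : L2I →L[ℝ] L2I) (u₀ v₀ : L2I) (U : L2T T) (f g : Curve T) :
    ∃ p ∈ strongSolutions T a, ∃ r ∈ strongSolutions T (-b),
      p.1.1.ev 0 = u₀ ∧ r.1.1.ev 0 = v₀ ∧ p.2.1 = q • r.2.1 ∧ r.2.2 = U ∧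
      p.1.2 = r.1.1.map A + f ∧ r.1.2 = p.1.1.map B + g := by
  have hb' : -b < 0 := by linarith
  -- solve first for `v`, whose trace at `x = 0` is then the inflow of `u`
  choose r hr' hr using fun z : Curve T × Curve T =>
    exists_strongSolution_of_neg (T := T) hb' v₀ U (z.1.map B + g)
  choose p hp' hp using fun z : Curve T × Curve T =>
    exists_strongSolution_of_pos (T := T) ha u₀ (q • (r z).2.1) (z.2.map A + f)
  obtain ⟨m, hm⟩ : ∃ m : ℝ, m = a * q ^ 2 / b := ⟨_, rfl⟩
  have hm0 : 0 < m := by rw [hm]; positivity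
  have hbm : b * m = a * q ^ 2 := by rw [hm]; field_simp
  obtain ⟨C, hC⟩ : ∃ C : ℝ, C = ‖A‖ ^ 2 / m + m * ‖B‖ ^ 2 := ⟨_, rfl⟩
  have hC0 : 0 ≤ C := by rw [hC]; positivity
  have hmap : ∀ (D : L2I →L[ℝ] L2I) (w w' h : Curve T),
      (w.map D + h) - (w'.map D + h) = (w - w').map D := fun D w w' h =>
    Curve.ext_ev fun t _ => by simp
  obtain ⟨z, hz⟩ := exists_fixedPoint_of_half (κ := 2 + 2 * C) hm0 (by linarith)
    (fun z => ((p z).1.1, (r z).1.1)) <| by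
      intro z z' N hN hle
      have e1 : (p z - p z').1.1.ev 0 = 0 := by
        change (p z).1.1.ev 0 - (p z').1.1.ev 0 = 0
        rw [(hp z).1, (hp z').1, sub_self]
      have e2 : (r z - r z').1.1.ev 0 = 0 := by
        change (r z).1.1.ev 0 - (r z').1.1.ev 0 = 0
        rw [(hr z).1, (hr z').1, sub_self]
      have e3 : (p z - p z').2.1 = q • (r z - r z').2.1 := by
        change (p z).2.1 - (p z').2.1 = q • ((r z).2.1 - (r z').2.1)
        rw [(hp z).2.1, (hp z').2.1, smul_sub]
      have e4 : (r z - r z').2.2 = 0 := by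
        change (r z).2.2 - (r z').2.2 = 0
        rw [(hr z).2.1, (hr z').2.1, sub_self]
      have e5 : (p z - p z').1.2 = (z.2 - z'.2).map A := by
        change (p z).1.2 - (p z').1.2 = _
        rw [(hp z).2.2, (hp z').2.2, hmap]
      have e6 : (r z - r z').1.2 = (z.1 - z'.1).map B := by
        change (r z).1.2 - (r z').1.2 = _
        rw [(hr z).2.2, (hr z').2.2, hmap]
      have h := coupled_energy_half ha hb hbm hm0 hC (Submodule.sub_mem _ (hp' z) (hp' z'))
        (Submodule.sub_mem _ (hr' z) (hr' z')) e1 e2 e3 e4 e5 e6 hN hle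
      rwa [Prod.fst_sub, Prod.fst_sub, Prod.fst_sub, Prod.fst_sub] at h
  have h1 : (p z).1.1 = z.1 := (Prod.ext_iff.1 hz).1
  have h2 : (r z).1.1 = z.2 := (Prod.ext_iff.1 hz).2
  exact ⟨p z, hp' _, r z, hr' _, (hp z).1, (hr z).1, (hp z).2.1, (hr z).2.1,
    by rw [h2]; exact (hp z).2.2, by rw [h1]; exact (hr z).2.2⟩

end

/-! ### Multiplication and integral operators -/

lemma norm_sq_L2I_eq (f : L2I) : ‖f‖ ^ 2 = ∫ x in Icc (0 : ℝ) 1, f x ^ 2 := by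
  rw [← real_inner_self_eq_norm_sq, L2.inner_def]
  simp [sq]

/-- Multiplication by a continuous function, as a symmetric bounded operator on `L²([0,1])`. -/
lemma exists_mulOperator {c : ℝ → ℝ} (hc : ContinuousOn c (Icc 0 1)) :
    ∃ M : L2I →L[ℝ] L2I,
      (∀ f : L2I, M f =ᵐ[volume.restrict (Icc (0 : ℝ) 1)] fun x => c x * f x) ∧
      ∀ f g : L2I, inner ℝ (M f) g = inner ℝ f (M g) := by
  obtain ⟨C, hC⟩ := isCompact_Icc.exists_bound_of_continuousOn hc
  have hle : ∀ f : L2I, ∀ᵐ x ∂(volume.restrict (Icc (0 : ℝ) 1)), ‖c x * f x‖ ≤ C * ‖f x‖ := by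
    intro f
    filter_upwards [ae_restrict_mem measurableSet_Icc] with x hx
    rw [norm_mul]
    exact mul_le_mul_of_nonneg_right (hC x hx) (norm_nonneg _)
  have hm : ∀ f : L2I, MemLp (fun x => c x * f x) 2 (volume.restrict (Icc (0 : ℝ) 1)) := fun f =>
    (Lp.memLp f).of_le_mul ((hc.aestronglyMeasurable measurableSet_Icc).mul
      (Lp.aestronglyMeasurable f)) (hle f)
  let L : L2I →ₗ[ℝ] L2I :=
    { toFun := fun f => (hm f).toLp
      map_add' := fun f g => Lp.ext <| by
        filter_upwards [(hm (f + g)).coeFn_toLp, (hm f).coeFn_toLp, (hm g).coeFn_toLp,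
          Lp.coeFn_add f g, Lp.coeFn_add (hm f).toLp (hm g).toLp] with x h1 h2 h3 h4 h5
        rw [h1, h5, Pi.add_apply, h2, h3, h4, Pi.add_apply, mul_add]
      map_smul' := fun s f => Lp.ext <| by
        filter_upwards [(hm (s • f)).coeFn_toLp, (hm f).coeFn_toLp,
          Lp.coeFn_smul s f, Lp.coeFn_smul s (hm f).toLp] with x h1 h2 h3 h4
        rw [h1, RingHom.id_apply, h4, Pi.smul_apply, h2, h3, Pi.smul_apply, smul_eq_mul,
          smul_eq_mul, mul_left_comm] }
  have hL : ∀ f : L2I, L f =ᵐ[volume.restrict (Icc (0 : ℝ) 1)] fun x => c x * f x :=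
    fun f => (hm f).coeFn_toLp
  refine ⟨L.mkContinuous C fun f => Lp.norm_le_mul_norm_of_ae_le_mul ?_, hL, fun f g => ?_⟩
  · filter_upwards [hL f, hle f] with x h1 h2
    rwa [h1]
  · change inner ℝ (L f) g = inner ℝ f (L g)
    rw [inner_L2I_eq_of_ae (hL f) .rfl, inner_L2I_eq_of_ae .rfl (hL g), innerI, innerI]
    exact intervalIntegral.integral_congr fun x _ => by ring

lemma kernelOp_eq (A : ℝ → ℝ → ℝ) (f : ℝ → ℝ) (x : ℝ) :
    kernelOp A f x = ∫ y in Icc (0 : ℝ) 1, A x y * f y := by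
  rw [kernelOp, intervalIntegral.integral_of_le zero_le_one, integral_Icc_eq_integral_Ioc]

/-- A symmetric square-integrable kernel defines a symmetric bounded operator on `L²([0,1])`, by
the Cauchy–Schwarz inequality. -/
lemma IsWeightKernel.exists_operator {A : ℝ → ℝ → ℝ} (hA : IsWeightKernel A) :
    ∃ K : L2I →L[ℝ] L2I,
      (∀ f : L2I, K f =ᵐ[volume.restrict (Icc (0 : ℝ) 1)] kernelOp A f) ∧
      ∀ f g : L2I, inner ℝ (K f) g = inner ℝ f (K g) := by
  set μ : Measure ℝ := volume.restrict (Icc (0 : ℝ) 1) with hμ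
  have hsq : Integrable (fun p : ℝ × ℝ => A p.1 p.2 ^ 2) (μ.prod μ) := hA.memLp.integrable_sq
  have hsec : ∀ᵐ x ∂μ, MemLp (fun y => A x y) 2 μ := by
    filter_upwards [hA.memLp.aestronglyMeasurable.prodMk_left, hsq.prod_right_ae] with x h1 h2
    exact (memLp_two_iff_integrable_sq h1).2 h2
  have hsqi : Integrable (fun x => ∫ y, A x y ^ 2 ∂μ) μ := hsq.integral_prod_left
  have hmeas : ∀ f : L2I, AEStronglyMeasurable (fun x => kernelOp A f x) μ := fun f => by
    simp only [kernelOp_eq]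
    exact (hA.memLp.aestronglyMeasurable.mul
      (Lp.aestronglyMeasurable f).comp_snd).integral_prod_right'
  have hle : ∀ f : L2I, ∀ᵐ x ∂μ, kernelOp A f x ^ 2 ≤ (∫ y, A x y ^ 2 ∂μ) * ‖f‖ ^ 2 := fun f => by
    filter_upwards [hsec] with x hx
    have h1 : kernelOp A f x = inner ℝ hx.toLp f := by
      rw [inner_L2I_eq_of_ae hx.coeFn_toLp .rfl]; rfl
    have h2 : ‖hx.toLp‖ ^ 2 = ∫ y, A x y ^ 2 ∂μ := by
      rw [norm_sq_L2I_eq]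
      refine integral_congr_ae ?_
      filter_upwards [hx.coeFn_toLp] with y hy
      rw [hy]
    rw [h1, ← h2, ← mul_pow, ← sq_abs]
    gcongr
    exact abs_real_inner_le_norm _ _
  have hm : ∀ f : L2I, MemLp (kernelOp A f) 2 μ := fun f => by
    refine (memLp_two_iff_integrable_sq (hmeas f)).2 ?_
    refine (hsqi.mul_const (‖f‖ ^ 2)).mono' ((hmeas f).pow 2) ?_
    filter_upwards [hle f] with x hx
    rwa [Real.norm_of_nonneg (sq_nonneg _)]
  have hint : ∀ f : L2I, ∀ᵐ x ∂μ, Integrable (fun y => A x y * f y) μ := fun f => by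
    filter_upwards [hsec] with x hx using hx.integrable_mul (Lp.memLp f)
  let L : L2I →ₗ[ℝ] L2I :=
    { toFun := fun f => (hm f).toLp
      map_add' := fun f g => Lp.ext <| by
        filter_upwards [(hm (f + g)).coeFn_toLp, (hm f).coeFn_toLp, (hm g).coeFn_toLp,
          Lp.coeFn_add (hm f).toLp (hm g).toLp, hint f, hint g] with x h1 h2 h3 h4 h5 h6
        rw [h1, h4, Pi.add_apply, h2, h3, kernelOp_eq, kernelOp_eq, kernelOp_eq,
          ← integral_add h5 h6]
        refine integral_congr_ae ?_
        filter_upwards [Lp.coeFn_add f g] with y hy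
        rw [hy, Pi.add_apply, mul_add]
      map_smul' := fun s f => Lp.ext <| by
        filter_upwards [(hm (s • f)).coeFn_toLp, (hm f).coeFn_toLp,
          Lp.coeFn_smul s (hm f).toLp] with x h1 h2 h3
        rw [h1, RingHom.id_apply, h3, Pi.smul_apply, h2, kernelOp_eq, kernelOp_eq, smul_eq_mul,
          ← integral_const_mul]
        refine integral_congr_ae ?_
        filter_upwards [Lp.coeFn_smul s f] with y hy
        rw [hy, Pi.smul_apply, smul_eq_mul, mul_left_comm] }
  have hL : ∀ f : L2I, L f =ᵐ[μ] kernelOp A f := fun f => (hm f).coeFn_toLp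
  have hCnn : 0 ≤ ∫ x, ∫ y, A x y ^ 2 ∂μ ∂μ :=
    integral_nonneg fun x => integral_nonneg fun y => sq_nonneg _
  refine ⟨L.mkContinuous (√(∫ x, ∫ y, A x y ^ 2 ∂μ ∂μ)) fun f => ?_, hL, fun f g => ?_⟩
  · refine (abs_le_of_sq_le_sq' ?_ (by positivity)).2
    rw [mul_pow, Real.sq_sqrt hCnn, norm_sq_L2I_eq, ← integral_mul_const]
    refine integral_mono_ae (Lp.memLp (L f)).integrable_sq (hsqi.mul_const _) ?_
    filter_upwards [hL f, hle f] with x h1 h2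
    rwa [h1]
  · have hprod : ∀ f g : L2I, MemLp (fun z : ℝ × ℝ => f z.2 * g z.1) 2 (μ.prod μ) := fun f g => by
      refine (memLp_two_iff_integrable_sq ((Lp.aestronglyMeasurable f).comp_snd.mul
        (Lp.aestronglyMeasurable g).comp_fst)).2 ?_
      refine ((Lp.memLp g).integrable_sq.mul_prod (Lp.memLp f).integrable_sq).congr ?_
      exact .of_forall fun z => by simp only [Pi.mul_apply]; ring
    have hdouble : ∀ f g : L2I, inner ℝ (L f) g =
        ∫ z : ℝ × ℝ, A z.1 z.2 * (f z.2 * g z.1) ∂(μ.prod μ) := fun f g => by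
      rw [inner_L2I_eq_of_ae (hL f) .rfl, innerI_eq_setIntegral,
        integral_prod (fun z : ℝ × ℝ => A z.1 z.2 * (f z.2 * g z.1))
          (hA.memLp.integrable_mul (hprod f g))]
      refine integral_congr_ae (.of_forall fun x => ?_)
      simp only
      rw [kernelOp_eq, ← integral_mul_const]
      exact integral_congr_ae (.of_forall fun y => by ring)
    change inner ℝ (L f) g = inner ℝ f (L g)
    rw [real_inner_comm (L g) f, hdouble, hdouble, ← integral_prod_swap]
    refine integral_congr_ae ?_
    filter_upwards [hA.symm] with z hz
    simp only [Prod.fst_swap, Prod.snd_swap]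
    rw [hz]; ring

/-! ### Time reversal and the adjoint system -/

lemma measurePreserving_reverse (T : ℝ) : MeasurePreserving (fun t : ℝ => T - t)
    (volume.restrict (Icc 0 T)) (volume.restrict (Icc 0 T)) := by
  have h := (Measure.measurePreserving_sub_left (volume : Measure ℝ) T).restrict_preimage
    (s := Icc 0 T) measurableSet_Icc
  simpa using h

/-- The curve `t ↦ w (T - t)`. -/
noncomputable def Curve.reverse {T : ℝ} (w : Curve T) : Curve T :=
  w.comp ⟨fun t => ⟨T - t, by linarith [t.2.2], by linarith [t.2.1]⟩, by fun_prop⟩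

/-- Time reversal of a quadruple; it changes the sign of the speed and of the source. -/
noncomputable def Quad.reverse {T : ℝ} (p : Quad T) : Quad T :=
  ((p.1.1.reverse, -p.1.2.reverse),
    (Lp.compMeasurePreserving _ (measurePreserving_reverse T) p.2.1,
     Lp.compMeasurePreserving _ (measurePreserving_reverse T) p.2.2))

lemma Quad.continuous_reverse {T : ℝ} : Continuous (Quad.reverse : Quad T → Quad T) := by
  have h1 : Continuous (Curve.reverse : Curve T → Curve T) := ContinuousMap.continuous_precomp _
  have h2 : Continuous fun g : L2T T =>
      Lp.compMeasurePreserving _ (measurePreserving_reverse T) g :=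
    (Lp.isometry_compMeasurePreserving (measurePreserving_reverse T)).continuous
  exact ((h1.comp (by fun_prop)).prodMk (h1.comp (by fun_prop)).neg).prodMk
    ((h2.comp (by fun_prop)).prodMk (h2.comp (by fun_prop)))

section
variable {T : ℝ} [hT : Fact (0 < T)]

lemma Curve.ev_reverse (w : Curve T) {t : ℝ} (ht : t ∈ Icc 0 T) :
    w.reverse.ev t = w.ev (T - t) := by
  rw [Curve.ev_of_mem _ ht, Curve.ev_of_mem _ ⟨by linarith [ht.2], by linarith [ht.1]⟩]
  rfl

lemma Represents.reverse {a : ℝ} {φ φt φx : ℝ → ℝ → ℝ} {p : Quad T} (hp : Represents a φ φt φx p) :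
    Represents (-a) (fun t => φ (T - t)) (fun t x => -φt (T - t) x) (fun t => φx (T - t))
      (Quad.reverse p) := by
  have hmem : ∀ {t}, t ∈ Icc 0 T → T - t ∈ Icc 0 T := fun ht =>
    ⟨by linarith [ht.2], by linarith [ht.1]⟩
  have hc : ∀ {θ : ℝ → ℝ → ℝ}, ContinuousOn (fun p : ℝ × ℝ => θ p.1 p.2) (Icc 0 T ×ˢ Icc 0 1) →
      ContinuousOn (fun p : ℝ × ℝ => θ (T - p.1) p.2) (Icc 0 T ×ˢ Icc 0 1) := fun h =>
    h.comp (by fun_prop : ContinuousOn (fun p : ℝ × ℝ => (T - p.1, p.2)) _)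
      fun p hp => ⟨hmem hp.1, hp.2⟩
  refine ⟨⟨hc hp.test.cont, (hc hp.test.cont_t).neg, hc hp.test.cont_x, fun t ht x hx => ?_,
    fun t ht x hx => hp.test.deriv_x _ (hmem ht) x hx⟩, fun t ht => ?_, fun t ht => ?_, ?_, ?_⟩
  · have h1 : HasDerivWithinAt (fun s => T - s) (-1) (Icc 0 T) t := by
      simpa using (hasDerivWithinAt_id t (Icc 0 T)).const_sub T
    have h2 := (hp.test.deriv_t _ (hmem ht) x hx).scomp t h1 fun s hs => hmem hs
    simpa [Function.comp_def] using h2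
  · rw [Quad.reverse, Curve.ev_reverse _ ht]
    exact hp.state _ (hmem ht)
  · rw [Quad.reverse, Curve.ev_neg, Curve.ev_reverse _ ht]
    filter_upwards [hp.source _ (hmem ht), Lp.coeFn_neg (p.1.2.ev (T - t))] with x h1 h2
    rw [h2, Pi.neg_apply, h1]; ring
  · exact (Lp.coeFn_compMeasurePreserving _ _).trans
      ((measurePreserving_reverse T).quasiMeasurePreserving.ae_eq_comp hp.left)
  · exact (Lp.coeFn_compMeasurePreserving _ _).trans
      ((measurePreserving_reverse T).quasiMeasurePreserving.ae_eq_comp hp.right)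

lemma Quad.reverse_mem_strongSolutions {a : ℝ} {p : Quad T} (hp : p ∈ strongSolutions T a) :
    Quad.reverse p ∈ strongSolutions T (-a) :=
  map_mem_closure Quad.continuous_reverse hp <| by
    rintro q ⟨_, _, _, hq⟩
    exact ⟨_, _, _, hq.reverse⟩

/-- Solvability of the adjoint system: after time reversal it has the form of the controlled
system, with the two components exchanged and with zero control. -/
lemma exists_adjoint_solution {a b q : ℝ} (ha : 0 < a) (hb : 0 < b) (hq : q ≠ 0)
    (A B : L2I →L[ℝ] L2I) (l₁ l₂ : L2I) (f g : Curve T) :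
    ∃ p ∈ strongSolutions T a, ∃ r ∈ strongSolutions T (-b),
      p.1.1.ev T = l₁ ∧ r.1.1.ev T = l₂ ∧ p.2.2 = 0 ∧ r.2.1 = q • p.2.1 ∧
      p.1.2 = -(r.1.1.map A + f) ∧ r.1.2 = -(p.1.1.map B + g) := by
  obtain ⟨r, hr, p, hp, h1, h2, h3, h4, h5, h6⟩ :=
    exists_coupled_solution hb ha hq B A l₂ l₁ (0 : L2T T) g.reverse f.reverse
  have hp' := Quad.reverse_mem_strongSolutions hp
  rw [neg_neg] at hp'
  have hmem : ∀ {t}, t ∈ Icc 0 T → T - t ∈ Icc 0 T := fun ht =>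
    ⟨by linarith [ht.2], by linarith [ht.1]⟩
  refine ⟨_, hp', _, Quad.reverse_mem_strongSolutions hr, ?_, ?_, ?_, ?_, ?_, ?_⟩
  · rw [Quad.reverse, Curve.ev_reverse _ end_mem_Icc_time, sub_self, h2]
  · rw [Quad.reverse, Curve.ev_reverse _ end_mem_Icc_time, sub_self, h1]
  · simp only [Quad.reverse, h4, map_zero]
  · simp only [Quad.reverse, h3]
    exact Lp.ext <| by
      filter_upwards [Lp.coeFn_compMeasurePreserving (q • p.2.1) (measurePreserving_reverse T),
        (measurePreserving_reverse T).quasiMeasurePreserving.ae_eq_comp (Lp.coeFn_smul q p.2.1),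
        Lp.coeFn_smul q (Lp.compMeasurePreserving _ (measurePreserving_reverse T) p.2.1),
        Lp.coeFn_compMeasurePreserving p.2.1 (measurePreserving_reverse T)] with t e1 e2 e3 e4
      rw [e1, e2, e3, Pi.smul_apply, e4]; rfl
  · refine Curve.ext_ev fun t ht => ?_
    simp only [Quad.reverse, h6, Curve.ev_neg, Curve.ev_reverse _ ht, Curve.ev_add, Curve.ev_map,
      Curve.ev_reverse _ (hmem ht), sub_sub_cancel]
  · refine Curve.ext_ev fun t ht => ?_
    simp only [Quad.reverse, h5, Curve.ev_neg, Curve.ev_reverse _ ht, Curve.ev_add, Curve.ev_map,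
      Curve.ev_reverse _ (hmem ht), sub_sub_cancel]

end

section
variable {T : ℝ} [hT : Fact (0 < T)]

/-! ### First variation of the cost -/

/-- The quadratic cost with weighting operators in place of kernels. -/
noncomputable def operatorCost (K₁ K₂ P₁ P₂ : L2I →L[ℝ] L2I) (R : ℝ) (w₁ w₂ : Curve T)
    (U : L2T T) : ℝ :=
  1 / 2 * ((∫ t in (0 : ℝ)..T,
        (inner ℝ (w₁.ev t) (K₁ (w₁.ev t)) + inner ℝ (w₂.ev t) (K₂ (w₂.ev t))))
      + R * inner ℝ U U)
    + 1 / 2 * inner ℝ (w₁.ev T) (P₁ (w₁.ev T)) + 1 / 2 * inner ℝ (w₂.ev T) (P₂ (w₂.ev T))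

/-- The first variation of the quadratic cost at `(w₁, w₂, U)` in the direction `(d₁, d₂, h)`. -/
noncomputable def costVariation (K₁ K₂ P₁ P₂ : L2I →L[ℝ] L2I) (R : ℝ) (w₁ w₂ : Curve T)
    (U : L2T T) (d₁ d₂ : Curve T) (h : L2T T) : ℝ :=
  (∫ t in (0 : ℝ)..T, (inner ℝ (d₁.ev t) (K₁ (w₁.ev t)) + inner ℝ (d₂.ev t) (K₂ (w₂.ev t))))
    + R * inner ℝ h U
    + inner ℝ (d₁.ev T) (P₁ (w₁.ev T)) + inner ℝ (d₂.ev T) (P₂ (w₂.ev T))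

lemma inner_add_smul_map {K : L2I →L[ℝ] L2I} (hK : ∀ f g, inner ℝ (K f) g = inner ℝ f (K g))
    (w d : L2I) (s : ℝ) : inner ℝ (w + s • d) (K (w + s • d)) =
      inner ℝ w (K w) + 2 * s * inner ℝ d (K w) + s ^ 2 * inner ℝ d (K d) := by
  have h : inner ℝ w (K d) = inner ℝ d (K w) := by rw [← hK, real_inner_comm]
  simp only [map_add, map_smul, inner_add_left, inner_add_right, real_inner_smul_left,
    real_inner_smul_right, h]
  ring

lemma operatorCost_add_smul {K₁ K₂ P₁ P₂ : L2I →L[ℝ] L2I}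
    (hK₁ : ∀ f g, inner ℝ (K₁ f) g = inner ℝ f (K₁ g))
    (hK₂ : ∀ f g, inner ℝ (K₂ f) g = inner ℝ f (K₂ g))
    (hP₁ : ∀ f g, inner ℝ (P₁ f) g = inner ℝ f (P₁ g))
    (hP₂ : ∀ f g, inner ℝ (P₂ f) g = inner ℝ f (P₂ g)) (R s : ℝ) (w₁ w₂ d₁ d₂ : Curve T)
    (U h : L2T T) :
    operatorCost K₁ K₂ P₁ P₂ R (w₁ + s • d₁) (w₂ + s • d₂) (U + s • h) =
      operatorCost K₁ K₂ P₁ P₂ R w₁ w₂ U + s * costVariation K₁ K₂ P₁ P₂ R w₁ w₂ U d₁ d₂ h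
        + s ^ 2 * operatorCost K₁ K₂ P₁ P₂ R d₁ d₂ h := by
  have hU : inner ℝ (U + s • h) (U + s • h) =
      inner ℝ U U + 2 * s * inner ℝ h U + s ^ 2 * inner ℝ h h := by
    rw [inner_add_left, inner_add_right, inner_add_right, real_inner_smul_left,
      real_inner_smul_left, real_inner_smul_right, real_inner_smul_right, real_inner_comm U h]
    ring
  have hint : ∫ t in (0 : ℝ)..T,
      (inner ℝ ((w₁ + s • d₁).ev t) (K₁ ((w₁ + s • d₁).ev t))
        + inner ℝ ((w₂ + s • d₂).ev t) (K₂ ((w₂ + s • d₂).ev t))) =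
      (∫ t in (0 : ℝ)..T,
        (inner ℝ (w₁.ev t) (K₁ (w₁.ev t)) + inner ℝ (w₂.ev t) (K₂ (w₂.ev t))))
      + 2 * s * (∫ t in (0 : ℝ)..T,
        (inner ℝ (d₁.ev t) (K₁ (w₁.ev t)) + inner ℝ (d₂.ev t) (K₂ (w₂.ev t))))
      + s ^ 2 * (∫ t in (0 : ℝ)..T,
        (inner ℝ (d₁.ev t) (K₁ (d₁.ev t)) + inner ℝ (d₂.ev t) (K₂ (d₂.ev t)))) := by
    have hc : ∀ (K : L2I →L[ℝ] L2I) (w : Curve T), Continuous fun t => K (w.ev t) :=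
      fun K w => K.continuous.comp w.continuous_ev
    have hi : ∀ w₁ w₂ d₁ d₂ : Curve T, IntervalIntegrable (fun t => inner ℝ (d₁.ev t) (K₁ (w₁.ev t))
        + inner ℝ (d₂.ev t) (K₂ (w₂.ev t))) volume 0 T := fun w₁ w₂ d₁ d₂ =>
      ((d₁.continuous_ev.inner (hc K₁ w₁)).add
        (d₂.continuous_ev.inner (hc K₂ w₂))).intervalIntegrable _ _
    rw [← intervalIntegral.integral_const_mul, ← intervalIntegral.integral_const_mul,
      ← intervalIntegral.integral_add (hi _ _ _ _) ((hi _ _ _ _).const_mul _),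
      ← intervalIntegral.integral_add ((hi _ _ _ _).add ((hi _ _ _ _).const_mul _))
        ((hi _ _ _ _).const_mul _)]
    refine intervalIntegral.integral_congr fun t _ => ?_
    simp only [Curve.ev_add, Curve.ev_smul, inner_add_smul_map hK₁, inner_add_smul_map hK₂]
    ring
  rw [operatorCost, operatorCost, operatorCost, costVariation, hint, hU]
  simp only [Curve.ev_add, Curve.ev_smul, inner_add_smul_map hP₁, inner_add_smul_map hP₂]
  ring

/-- Duality between the variation of the state and the co-states: the first variation of the cost
is the pairing of the variation `h` of the control with `R U + b λ₂(1,·)`. -/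
lemma costVariation_eq {a b q R : ℝ} (hb : b ≠ 0) {M₁ M₂ K₁ K₂ P₁ P₂ : L2I →L[ℝ] L2I}
    (hM₁ : ∀ f g, inner ℝ (M₁ f) g = inner ℝ f (M₁ g))
    (hM₂ : ∀ f g, inner ℝ (M₂ f) g = inner ℝ f (M₂ g))
    {w₁ w₂ : Curve T} {U h : L2T T} {d e p r : Quad T}
    (hd : d ∈ strongSolutions T a) (he : e ∈ strongSolutions T (-b))
    (hp : p ∈ strongSolutions T a) (hr : r ∈ strongSolutions T (-b))
    (hd0 : d.1.1.ev 0 = 0) (he0 : e.1.1.ev 0 = 0) (hde : d.2.1 = q • e.2.1) (he1 : e.2.2 = h)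
    (hdf : d.1.2 = e.1.1.map M₁) (hef : e.1.2 = d.1.1.map M₂)
    (hpT : p.1.1.ev T = P₁ (w₁.ev T)) (hrT : r.1.1.ev T = P₂ (w₂.ev T)) (hp1 : p.2.2 = 0)
    (hrp : r.2.1 = (q * (a / b)) • p.2.1)
    (hpf : p.1.2 = -(r.1.1.map M₂ + w₁.map K₁)) (hrf : r.1.2 = -(p.1.1.map M₁ + w₂.map K₂)) :
    costVariation K₁ K₂ P₁ P₂ R w₁ w₂ U d.1.1 e.1.1 h = inner ℝ h (R • U + b • r.2.2) := by
  have g1 := greenForm_eq_zero hd hp end_mem_Icc_time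
  have g2 := greenForm_eq_zero he hr end_mem_Icc_time
  simp only [greenForm, pairTo_self_eq_inner, hd0, he0, inner_zero_left, hp1, he1, hpT, hrT, hde,
    hrp, inner_zero_right, real_inner_smul_left, real_inner_smul_right] at g1 g2
  have hc : ∀ (K : L2I →L[ℝ] L2I) (w : Curve T), Continuous fun t => K (w.ev t) :=
    fun K w => K.continuous.comp w.continuous_ev
  have hsum : (∫ t in (0 : ℝ)..T,
        (inner ℝ (d.1.1.ev t) (p.1.2.ev t) + inner ℝ (d.1.2.ev t) (p.1.1.ev t)))
      + (∫ t in (0 : ℝ)..T,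
        (inner ℝ (e.1.1.ev t) (r.1.2.ev t) + inner ℝ (e.1.2.ev t) (r.1.1.ev t)))
      = -∫ t in (0 : ℝ)..T,
        (inner ℝ (d.1.1.ev t) (K₁ (w₁.ev t)) + inner ℝ (e.1.1.ev t) (K₂ (w₂.ev t))) := by
    rw [← intervalIntegral.integral_neg, ← intervalIntegral.integral_add
      (Continuous.intervalIntegrable (by fun_prop) _ _)
      (Continuous.intervalIntegrable (by fun_prop) _ _)]
    refine intervalIntegral.integral_congr fun t _ => ?_
    simp only [hdf, hef, hpf, hrf, Curve.ev_neg, Curve.ev_add, Curve.ev_map, inner_neg_right,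
      inner_add_right, hM₁, hM₂]
    ring
  rw [costVariation, inner_add_right, real_inner_smul_right, real_inner_smul_right]
  have hcancel : b * (q * (a / b) * inner ℝ e.2.1 p.2.1) = a * (q * inner ℝ e.2.1 p.2.1) := by
    field_simp
  linarith

end

lemma eq_zero_of_forall_mul_add_sq_nonneg {G H : ℝ} (h : ∀ s : ℝ, 0 ≤ s * G + s ^ 2 * H) :
    G = 0 := by
  have h1 := h (-G / (1 + |H|))
  have hH : 0 < 1 + |H| := by positivity
  have h2 : -G / (1 + |H|) * G + (-G / (1 + |H|)) ^ 2 * H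
      = -(G ^ 2 * (1 + |H| - H)) / (1 + |H|) ^ 2 := by field_simp; ring
  rw [h2, le_div_iff₀ (by positivity), zero_mul] at h1
  have h3 : 1 ≤ 1 + |H| - H := by linarith [le_abs_self H]
  have h4 : G ^ 2 ≤ 0 := by nlinarith [sq_nonneg G]
  exact pow_eq_zero_iff two_ne_zero |>.1 (le_antisymm h4 (sq_nonneg G))

lemma LQData.cost_eq {D : LQData} [hT : Fact (0 < D.T)] {K₁ K₂ P₁ P₂ : L2I →L[ℝ] L2I}
    (hK₁ : ∀ f : L2I, K₁ f =ᵐ[volume.restrict (Icc (0 : ℝ) 1)] kernelOp D.Q₁ f)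
    (hK₂ : ∀ f : L2I, K₂ f =ᵐ[volume.restrict (Icc (0 : ℝ) 1)] kernelOp D.Q₂ f)
    (hP₁ : ∀ f : L2I, P₁ f =ᵐ[volume.restrict (Icc (0 : ℝ) 1)] kernelOp D.Pf₁ f)
    (hP₂ : ∀ f : L2I, P₂ f =ᵐ[volume.restrict (Icc (0 : ℝ) 1)] kernelOp D.Pf₂ f)
    {u v : ℝ → L2I} {U : ℝ → ℝ} {w₁ w₂ : Curve D.T} {U' : L2T D.T}
    (hu : ∀ t ∈ Icc 0 D.T, w₁.ev t = u t) (hv : ∀ t ∈ Icc 0 D.T, w₂.ev t = v t)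
    (hU : U' =ᵐ[volume.restrict (Icc 0 D.T)] U) :
    D.cost u v U = operatorCost K₁ K₂ P₁ P₂ D.R w₁ w₂ U' := by
  have hk : ∀ {K : L2I →L[ℝ] L2I} {A : ℝ → ℝ → ℝ},
      (∀ f : L2I, K f =ᵐ[volume.restrict (Icc (0 : ℝ) 1)] kernelOp A f) → ∀ f : L2I,
      inner ℝ f (K f) = innerI f (kernelOp A f) := fun h f => inner_L2I_eq_of_ae .rfl (h f)
  have hTm := end_mem_Icc_time (T := D.T)
  have hUU : D.R * inner ℝ U' U' = ∫ t in (0 : ℝ)..D.T, D.R * U' t ^ 2 := by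
    rw [intervalIntegral.integral_const_mul, L2.inner_def,
      intervalIntegral.integral_of_le hT.out.le, ← integral_Icc_eq_integral_Ioc]
    simp [sq]
  have hc : ∀ (K : L2I →L[ℝ] L2I) (w : Curve D.T), Continuous fun t => K (w.ev t) :=
    fun K w => K.continuous.comp w.continuous_ev
  have hi : IntervalIntegrable (fun t => D.R * U' t ^ 2) volume 0 D.T := by
    rw [intervalIntegrable_iff_integrableOn_Icc_of_le hT.out.le]
    exact (Lp.memLp U').integrable_sq.const_mul _
  have hi' : IntervalIntegrable (fun t => inner ℝ (w₁.ev t) (K₁ (w₁.ev t))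
      + inner ℝ (w₂.ev t) (K₂ (w₂.ev t))) volume 0 D.T :=
    ((w₁.continuous_ev.inner (hc K₁ w₁)).add
      (w₂.continuous_ev.inner (hc K₂ w₂))).intervalIntegrable _ _
  rw [LQData.cost, operatorCost, hUU, ← intervalIntegral.integral_add hi' hi]
  rw [hk hP₁, hk hP₂, hu _ hTm, hv _ hTm]
  congr 3
  rw [intervalIntegral.integral_of_le hT.out.le, intervalIntegral.integral_of_le hT.out.le,
    ← integral_Icc_eq_integral_Ioc, ← integral_Icc_eq_integral_Ioc]
  refine integral_congr_ae ?_
  filter_upwards [hU, ae_restrict_mem measurableSet_Icc] with t h1 ht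
  rw [h1, hk hK₁, hk hK₂, hu t ht, hv t ht]

/-! ### States as quadruples -/

/-- The two components of a state of the controlled system, as quadruples that satisfy Green's
formula against all continuously differentiable functions. -/
structure IsStatePair (D : LQData) [Fact (0 < D.T)] (M₁ M₂ : L2I →L[ℝ] L2I) (p r : Quad D.T) :
    Prop where
  weak_fst : ∀ p' ∈ classicalSolutions D.T D.ε₁, greenForm D.ε₁ D.T p p' = 0
  weak_snd : ∀ r' ∈ classicalSolutions D.T (-D.ε₂), greenForm (-D.ε₂) D.T r r' = 0
  source_fst : p.1.2 = r.1.1.map M₁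
  source_snd : r.1.2 = p.1.1.map M₂
  boundary : p.2.1 = D.q • r.2.1
  init_fst : p.1.1.ev 0 = D.u₀
  init_snd : r.1.1.ev 0 = D.v₀

section
variable {D : LQData} [hT : Fact (0 < D.T)] {M₁ M₂ : L2I →L[ℝ] L2I}

lemma IsStatePair.isState {p r : Quad D.T} (h : IsStatePair D M₁ M₂ p r)
    (hM₁ : ∀ f : L2I, M₁ f =ᵐ[volume.restrict (Icc (0 : ℝ) 1)] fun x => D.c₁ x * f x)
    (hM₂ : ∀ f : L2I, M₂ f =ᵐ[volume.restrict (Icc (0 : ℝ) 1)] fun x => D.c₂ x * f x) :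
    D.IsState p.1.1.ev r.1.1.ev r.2.2 := by
  refine ⟨Lp.memLp _, p.2.1, p.2.2, r.2.1, r.2.2,
    (isWeakTransport_iff (fun _ _ => rfl) (fun t _ => ?_) .rfl .rfl).2 h.weak_fst,
    (isWeakTransport_iff (fun _ _ => rfl) (fun t _ => ?_) .rfl .rfl).2 h.weak_snd,
    ?_, .of_forall fun _ => rfl, h.init_fst, h.init_snd⟩
  · rw [h.source_fst]; exact hM₁ _
  · rw [h.source_snd]; exact hM₂ _
  · rw [h.boundary]
    exact Lp.coeFn_smul _ _

lemma LQData.IsState.exists_isStatePair {u v : ℝ → L2I} {U : ℝ → ℝ} (h : D.IsState u v U)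
    (hM₁ : ∀ f : L2I, M₁ f =ᵐ[volume.restrict (Icc (0 : ℝ) 1)] fun x => D.c₁ x * f x)
    (hM₂ : ∀ f : L2I, M₂ f =ᵐ[volume.restrict (Icc (0 : ℝ) 1)] fun x => D.c₂ x * f x) :
    ∃ p r : Quad D.T, IsStatePair D M₁ M₂ p r ∧ (∀ t ∈ Icc 0 D.T, p.1.1.ev t = u t) ∧
      (∀ t ∈ Icc 0 D.T, r.1.1.ev t = v t) ∧ r.2.2 =ᵐ[volume.restrict (Icc 0 D.T)] U := by
  obtain ⟨-, ul, ur, vl, vr, hu, hv, hul, hvr, hu0, hv0⟩ := h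
  have hwu := fun t (ht : t ∈ Icc 0 D.T) => Curve.ev_ofContinuousOn u hu.cont ht
  have hwv := fun t (ht : t ∈ Icc 0 D.T) => Curve.ev_ofContinuousOn v hv.cont ht
  generalize Curve.ofContinuousOn u hu.cont = wu at hwu
  generalize Curve.ofContinuousOn v hv.cont = wv at hwv
  refine ⟨((wu, wv.map M₁), (hu.memLp_left.toLp, hu.memLp_right.toLp)),
    ((wv, wu.map M₂), (hv.memLp_left.toLp, hv.memLp_right.toLp)),
    ⟨(isWeakTransport_iff hwu (fun t ht => ?_) hu.memLp_left.coeFn_toLp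
        hu.memLp_right.coeFn_toLp).1 hu,
      (isWeakTransport_iff hwv (fun t ht => ?_) hv.memLp_left.coeFn_toLp
        hv.memLp_right.coeFn_toLp).1 hv,
      rfl, rfl, ?_, ?_, ?_⟩, hwu, hwv, hv.memLp_right.coeFn_toLp.trans hvr⟩
  · rw [← hwv t ht]; exact hM₁ _
  · rw [← hwu t ht]; exact hM₂ _
  · refine Lp.ext ?_
    filter_upwards [hul, hu.memLp_left.coeFn_toLp, hv.memLp_left.coeFn_toLp,
      Lp.coeFn_smul D.q hv.memLp_left.toLp] with t h1 h2 h3 h4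
    rw [h2, h1, h4, Pi.smul_apply, h3, smul_eq_mul]
  · exact (hwu 0 zero_mem_Icc_time).trans hu0
  · exact (hwv 0 zero_mem_Icc_time).trans hv0

/-- Adding a strong solution of the system with zero initial values to a state gives a state. -/
lemma IsStatePair.add_smul {p r d e : Quad D.T} (h : IsStatePair D M₁ M₂ p r)
    (hd : d ∈ strongSolutions D.T D.ε₁) (he : e ∈ strongSolutions D.T (-D.ε₂))
    (hd0 : d.1.1.ev 0 = 0) (he0 : e.1.1.ev 0 = 0) (hde : d.2.1 = D.q • e.2.1)
    (hdf : d.1.2 = e.1.1.map M₁) (hef : e.1.2 = d.1.1.map M₂) (s : ℝ) :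
    IsStatePair D M₁ M₂ (p + s • d) (r + s • e) where
  weak_fst p' hp' := by
    rw [greenForm_add_smul, h.weak_fst p' hp', greenForm_eq_zero hd
      (Submodule.le_topologicalClosure _ hp') end_mem_Icc_time, mul_zero, add_zero]
  weak_snd p' hp' := by
    rw [greenForm_add_smul, h.weak_snd p' hp', greenForm_eq_zero he
      (Submodule.le_topologicalClosure _ hp') end_mem_Icc_time, mul_zero, add_zero]
  source_fst := by
    change p.1.2 + s • d.1.2 = (r.1.1 + s • e.1.1).map M₁
    rw [h.source_fst, hdf]
    exact Curve.ext_ev fun t _ => by simp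
  source_snd := by
    change r.1.2 + s • e.1.2 = (p.1.1 + s • d.1.1).map M₂
    rw [h.source_snd, hef]
    exact Curve.ext_ev fun t _ => by simp
  boundary := by
    change p.2.1 + s • d.2.1 = D.q • (r.2.1 + s • e.2.1)
    rw [h.boundary, hde, smul_add, smul_comm]
  init_fst := by
    change p.1.1.ev 0 + s • d.1.1.ev 0 = D.u₀
    rw [h.init_fst, hd0, smul_zero, add_zero]
  init_snd := by
    change r.1.1.ev 0 + s • e.1.1.ev 0 = D.v₀
    rw [h.init_snd, he0, smul_zero, add_zero]

end

/-! ### Optimality conditions -/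

theorem theorem1 (D : LQData) (hD : D.Standing) (u v : ℝ → L2I) (U : ℝ → ℝ)
    (hopt : D.IsOptimal u v U) :
    D.IsState u v U ∧
    ∃ (lam₁ lam₂ : ℝ → L2I) (l₁ r₁ l₂ r₂ : ℝ → ℝ),
      -- `-λ₁ₜ = ε₁ λ₁ₓ + c₂ λ₂ + Q₁ u`, with `λ₁(0,·) = l₁` and `λ₁(1,·) = r₁`
      IsWeakTransport D.T D.ε₁
        (fun t x => -(D.c₂ x * lam₂ t x + kernelOp D.Q₁ (u t) x)) lam₁ l₁ r₁ ∧
      -- `-λ₂ₜ = -ε₂ λ₂ₓ + c₁ λ₁ + Q₂ v`, with `λ₂(0,·) = l₂` and `λ₂(1,·) = r₂`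
      IsWeakTransport D.T (-D.ε₂)
        (fun t x => -(D.c₁ x * lam₁ t x + kernelOp D.Q₂ (v t) x)) lam₂ l₂ r₂ ∧
      -- boundary conditions
      (∀ᵐ t ∂(volume.restrict (Icc 0 D.T)), r₁ t = 0) ∧
      (∀ᵐ t ∂(volume.restrict (Icc 0 D.T)), l₂ t = D.q * (D.ε₁ / D.ε₂) * l₁ t) ∧
      -- terminal conditions
      (∀ᵐ x ∂(volume.restrict (Icc (0 : ℝ) 1)), lam₁ D.T x = kernelOp D.Pf₁ (u D.T) x) ∧
      (∀ᵐ x ∂(volume.restrict (Icc (0 : ℝ) 1)), lam₂ D.T x = kernelOp D.Pf₂ (v D.T) x) ∧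
      -- the optimal control
      (∀ᵐ t ∂(volume.restrict (Icc 0 D.T)), U t = -(D.ε₂ / D.R) * r₂ t) := by
  have : Fact (0 < D.T) := ⟨hD.T_pos⟩
  obtain ⟨K₁, hK₁, hK₁s⟩ := hD.Q₁_nonneg.exists_operator
  obtain ⟨K₂, hK₂, hK₂s⟩ := hD.Q₂_nonneg.exists_operator
  obtain ⟨P₁, hP₁, hP₁s⟩ := hD.Pf₁_nonneg.exists_operator
  obtain ⟨P₂, hP₂, hP₂s⟩ := hD.Pf₂_nonneg.exists_operator
  obtain ⟨M₁, hM₁, hM₁s⟩ := exists_mulOperator hD.c₁_cont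
  obtain ⟨M₂, hM₂, hM₂s⟩ := exists_mulOperator hD.c₂_cont
  obtain ⟨y, z, hyz, hyu, hzv, hzU⟩ := hopt.1.exists_isStatePair hM₁ hM₂
  have hε₁ := hD.ε₁_pos
  have hε₂ := hD.ε₂_pos
  have hTm := end_mem_Icc_time (T := D.T)
  obtain ⟨p, hp, r, hr, hpT, hrT, hp1, hrp, hpf, hrf⟩ := exists_adjoint_solution hε₁ hε₂
    (mul_ne_zero hD.q_ne (div_pos hε₁ hε₂).ne') M₂ M₁ (P₁ (y.1.1.ev D.T)) (P₂ (z.1.1.ev D.T))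
    (y.1.1.map K₁) (z.1.1.map K₂)
  -- the first variation of the cost vanishes in every direction
  have hvar : ∀ h : L2T D.T, inner ℝ h (D.R • z.2.2 + D.ε₂ • r.2.2) = 0 := by
    intro h
    obtain ⟨d, hd, e, he, hd0, he0, hde, he1, hdf, hef⟩ := exists_coupled_solution hε₁ hε₂ hD.q_ne
      M₁ M₂ 0 0 h (0 : Curve D.T) 0
    rw [add_zero] at hdf hef
    rw [← costVariation_eq hε₂.ne' (K₁ := K₁) (K₂ := K₂) hM₁s hM₂s hd he hp hr hd0 he0 hde he1 hdf
      hef hpT hrT hp1 hrp hpf hrf]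
    refine eq_zero_of_forall_mul_add_sq_nonneg
      (H := operatorCost K₁ K₂ P₁ P₂ D.R d.1.1 e.1.1 h) fun s => ?_
    have hs := (hyz.add_smul hd he hd0 he0 hde hdf hef s).isState hM₁ hM₂
    have hle := hopt.2 _ _ _ hs
    have e1 := LQData.cost_eq hK₁ hK₂ hP₁ hP₂ hyu hzv hzU
    have e2 := LQData.cost_eq (D := D) hK₁ hK₂ hP₁ hP₂ (w₁ := (y + s • d).1.1)
      (w₂ := (z + s • e).1.1) (U' := (z + s • e).2.2) (fun _ _ => rfl) (fun _ _ => rfl) .rfl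
    have e3 := operatorCost_add_smul hK₁s hK₂s hP₁s hP₂s D.R s y.1.1 z.1.1 d.1.1 e.1.1 z.2.2 h
    rw [← he1] at e3 ⊢
    have e4 : operatorCost K₁ K₂ P₁ P₂ D.R (y + s • d).1.1 (z + s • e).1.1 (z + s • e).2.2 =
      operatorCost K₁ K₂ P₁ P₂ D.R (y.1.1 + s • d.1.1) (z.1.1 + s • e.1.1)
        (z.2.2 + s • e.2.2) := rfl
    linarith
  have hzero : D.R • z.2.2 + D.ε₂ • r.2.2 = 0 := inner_self_eq_zero.1 (hvar _)
  have hweak : ∀ {a : ℝ} {p : Quad D.T}, p ∈ strongSolutions D.T a →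
      ∀ p' ∈ classicalSolutions D.T a, greenForm a D.T p p' = 0 := fun hp p' hp' =>
    greenForm_eq_zero hp (Submodule.le_topologicalClosure _ hp') hTm
  -- the source terms of the co-state equations, as functions
  have hsrc : ∀ {c : ℝ → ℝ} {A : ℝ → ℝ → ℝ} {M K : L2I →L[ℝ] L2I},
      (∀ f : L2I, M f =ᵐ[volume.restrict (Icc (0 : ℝ) 1)] fun x => c x * f x) →
      (∀ f : L2I, K f =ᵐ[volume.restrict (Icc (0 : ℝ) 1)] kernelOp A f) → ∀ f g : L2I,
      ((-(M f + K g) : L2I) : ℝ → ℝ) =ᵐ[volume.restrict (Icc (0 : ℝ) 1)]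
        fun x => -(c x * f x + kernelOp A g x) := by
    intro c A M K hM hK f g
    filter_upwards [Lp.coeFn_neg (M f + K g), Lp.coeFn_add (M f) (K g), hM f, hK g]
      with x h1 h2 h3 h4
    rw [h1, Pi.neg_apply, h2, Pi.add_apply, h3, h4]
  refine ⟨hopt.1, p.1.1.ev, r.1.1.ev, p.2.1, p.2.2, r.2.1, r.2.2,
    (isWeakTransport_iff (fun _ _ => rfl) (fun t ht => ?_) .rfl .rfl).2 (hweak hp),
    (isWeakTransport_iff (fun _ _ => rfl) (fun t ht => ?_) .rfl .rfl).2 (hweak hr),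
    ?_, ?_, ?_, ?_, ?_⟩
  · rw [hpf, ← hyu t ht]; exact hsrc hM₂ hK₁ _ _
  · rw [hrf, ← hzv t ht]; exact hsrc hM₁ hK₂ _ _
  · rw [hp1]; exact Lp.coeFn_zero _ _ _
  · rw [hrp]; exact Lp.coeFn_smul _ _
  · rw [hpT, hyu _ hTm]; exact hP₁ _
  · rw [hrT, hzv _ hTm]; exact hP₂ _
  · have hz : z.2.2 = (-(D.ε₂ / D.R)) • r.2.2 := by
      have hR := hD.R_pos.ne'
      rw [← smul_right_injective _ hR |>.eq_iff, smul_smul, eq_neg_of_add_eq_zero_left hzero,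
        ← neg_smul]
      congr 1
      field_simp
    filter_upwards [hzU, Lp.coeFn_smul (-(D.ε₂ / D.R)) r.2.2] with t h1 h2
    rw [← h1, hz, h2, Pi.smul_apply, smul_eq_mul]
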